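/- Let $r\ge 1$, $A_i\in\mathbb R^{n\times n}$ and $B_i\in\mathbb R^{n\times m}$ for $i=0,\dots,r-1$, $Q\in\mathbb R^{n\times n}$, $L\in\mathbb R^{n\times m}$, $R\in\mathbb R^{m\times m}$ with $\begin{bmatrix}Q&L\\L^T&R\end{bmatrix}\succeq0$ and $R\succ0$, and let $C\in\mathbb R^{l\times n}$ satisfy $C^TC=Q-LR^{-1}L^T$. For $F\in\mathbb R^{m\times n}$ let $\mathcal S_F(S)=\sum_{i}(A_i+B_iF)S(A_i+B_iF)^T$ on $\mathbb R^{n\times n}$, with adjoint $\mathcal S_F^*(S)=\sum_{i}(A_i+B_iF)^TS(A_i+B_iF)$, and let $\rho$ denote the spectral radius. A pair $(\{A_i\},\{B_i\})$ is called stabilizable if $\rho(\mathcal S_F)<1$ for some $F$. Assume that $(\{A_i\},\{B_i\})$ is stabilizable and that $(\{A_i-B_iR^{-1}L^T\},C)$ is detectable, that is, $(\{(A_i-B_iR^{-1}L^T)^T\},\{C_i^T\})$ is stabilizable for $C_0=C$, $C_i=0$ $(i\ge1)$. For $M\in\mathbb R^{p\times q}$, $N\in\mathbb R^{p'\times q'}$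 let $M\ltimes N=(M\otimes I_{p'/q})N$ if $q\mid p'$ and $M\ltimes N=M(N\otimes I_{q/p'})$ if $p'\mid q$ (left semi-tensor product). Let $\Pi$ be the permutation matrix with $\Pi^T(X\otimes I_r)\Pi=I_r\otimes X$ for all $X\in\mathbb R^{n\times n}$, and let $A\in\mathbb R^{rn\times n}$, $B\in\mathbb R^{rn\times m}$ be $\Pi$ times the block columns with blocks $A_i-B_iR^{-1}L^T$ and $B_iR^{-1/2}$, respectively. Consider the stochastic discrete-time algebraic Riccati equation (SDARE) $$X=\mathcal D(X):=A^T\ltimes X\ltimes(I_{rn}+BB^T\ltimes X)^{-1}\ltimes A+C^TC .$$ A solution $X$ is called stabilizing if $\rho(\mathcal S_{F_X})<1$, where $F_X=-\big(\sum_iB_i^TXB_i+R\big)^{-1}\big(\sum_iA_i^TXB_i+L\big)^T$. Let $X_0=0$, $X_{t+1}=\mathcal D(X_t)$ be the fixed point iteration, and let $A_0^{\rm d}=A$, $G_0=BB^T$, $H_0=C^TC$ and, with $I=I_{r^{2^k}n}$, $$A^{\rm d}_{k+1}=A^{\rm d}_k\ltimes(I+G_k\ltimes H_k)^{-1}\ltimes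 A^{\rm d}_k,$$ $$G_{k+1}=G_k\otimes I_{r^{2^k}}+A^{\rm d}_k\ltimes(I+G_k\ltimes H_k)^{-1}\ltimes G_k\ltimes (A_k^{\rm d})^T,$$ $$H_{k+1}=H_k+(A_k^{\rm d})^T\ltimes H_k\ltimes(I+G_k\ltimes H_k)^{-1}\ltimes A^{\rm d}_k$$ be the doubling iteration. **Theorem.** All matrices $I+G_k\ltimes H_k$ are invertible. The SDARE has a unique positive semidefinite stabilizing solution $X_\star$. One has $H_{k+1}\succeq H_k$ for all $k$, and either $H_{k+1}\ne H_k$ for all $k$, or the sequence is finite: there is $K$ such that $H_k=X_\star$ for all $k\ge K$ and $H_{k+1}\neq H_k$ for $k<K$. Moreover $H_k\to X_\star$ R-quadratically. That is, with $F_\star=F_{X_\star}$, there is $Y\succ0$ in $\mathbb R^{n\times n}$, independent of $k$ and $t$, such that $I_n-YX_\star$ is invertible and $$X_t\succeq X_\star-(\mathcal S_{F_\star}^*)^{t}\big(X_\star(I_n-YX_\star)^{-1}\big)\quad(t\ge0),$$ $$H_k\succeq X_\star-(\mathcal S_{F_\star}^*)^{2^k}\big(X_\star(I_n-YX_\star)^{-1}\big)\quad(k\ge0).$$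 Furthermore $\rho(\mathcal S_{F_\star})<1$ and, if $X_\star\neq0$, the following limit exists for every norm on $\mathbb R^{n\times n}$, does not depend on the norm, and satisfies $$\lim_{k\to\infty}\left(\frac{\|H_k-X_\star\|}{\|X_\star\|}\right)^{1/2^k}\le\rho(\mathcal S_{F_\star}).$$ -/

import Mathlib

open Matrix Filter Topology
open scoped Kronecker NNReal ENNReal MatrixOrder

noncomputable section

namespace SDARE

/-! Matrices whose number of rows or columns is a multiple `n * s` of another dimension `n` are
indexed by the product type `n × s`, ordered lexicographically (this is the indexing used by
the Kronecker product `⊗ₖ`).  The identification of `(n × s) × s'` with `n × (s × s')` is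
compatible with the lexicographic orders, so it is the identity on matrices with numerical
indices. -/

section SemiTensor

variable {m n p q s : Type*} [Fintype m] [Fintype n] [Fintype p] [Fintype q] [Fintype s]
  [DecidableEq s]

/-- The left semi-tensor product `M ⋉ N = (M ⊗ I_s) N`, in the case where the number of rows of
`N` is `s` times the number of columns of `M`. -/
def ltimesL (M : Matrix m n ℝ) (N : Matrix (n × s) q ℝ) : Matrix (m × s) q ℝ :=
  (M ⊗ₖ (1 : Matrix s s ℝ)) * N

/-- The left semi-tensor product `M ⋉ N = M (N ⊗ I_s)`, in the case where the number of columns of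
`M` is `s` times the number of rows of `N`. -/
def ltimesR (M : Matrix m (p × s) ℝ) (N : Matrix p q ℝ) : Matrix m (q × s) ℝ :=
  M * (N ⊗ₖ (1 : Matrix s s ℝ))

end SemiTensor

section Operators

variable {n m l r : ℕ}

/-- The operator `S_F : S ↦ ∑ i, (A_i + B_i F) S (A_i + B_i F)ᵀ` on `ℝ^{n × n}`. -/
def opS (A : Fin r → Matrix (Fin n) (Fin n) ℝ) (B : Fin r → Matrix (Fin n) (Fin m) ℝ)
    (F : Matrix (Fin m) (Fin n) ℝ) :
    Module.End ℝ (Matrix (Fin n) (Fin n) ℝ) where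
  toFun S := ∑ i, (A i + B i * F) * S * (A i + B i * F)ᵀ
  map_add' S T := by
    rw [← Finset.sum_add_distrib]
    exact Finset.sum_congr rfl fun i _ => by
      rw [Matrix.mul_add _ S T]
      exact Matrix.add_mul _ _ _
  map_smul' c S := by simp [Finset.smul_sum]

/-- The operator `S_F^* : S ↦ ∑ i, (A_i + B_i F)ᵀ S (A_i + B_i F)` on `ℝ^{n × n}`. -/
def opSAdj (A : Fin r → Matrix (Fin n) (Fin n) ℝ) (B : Fin r → Matrix (Fin n) (Fin m) ℝ)
    (F : Matrix (Fin m) (Fin n) ℝ) :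
    Module.End ℝ (Matrix (Fin n) (Fin n) ℝ) where
  toFun S := ∑ i, (A i + B i * F)ᵀ * S * (A i + B i * F)
  map_add' S T := by
    rw [← Finset.sum_add_distrib]
    exact Finset.sum_congr rfl fun i _ => by
      rw [Matrix.mul_add _ S T]
      exact Matrix.add_mul _ _ _
  map_smul' c S := by simp [Finset.smul_sum]

/-- `opSAdj` is the adjoint of `opS` for the trace inner product `⟨S, T⟩ = tr (Sᵀ T)`. -/
theorem trace_opS_eq_trace_opSAdj (A : Fin r → Matrix (Fin n) (Fin n) ℝ)
    (B : Fin r → Matrix (Fin n) (Fin m) ℝ) (F : Matrix (Fin m) (Fin n) ℝ)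
    (S T : Matrix (Fin n) (Fin n) ℝ) :
    ((opS A B F S)ᵀ * T).trace = (Sᵀ * opSAdj A B F T).trace := by
  simp only [opS, opSAdj, LinearMap.coe_mk, AddHom.coe_mk, Matrix.transpose_sum,
    Matrix.sum_mul, Matrix.mul_sum, Matrix.trace_sum, Matrix.transpose_mul,
    Matrix.transpose_transpose]
  refine Finset.sum_congr rfl fun i _ => ?_
  rw [Matrix.mul_assoc, Matrix.trace_mul_comm]
  simp only [Matrix.mul_assoc]

/-- The spectral radius of a linear operator on `ℝ^{n × n}`: the largest modulus of a complex
eigenvalue of the matrix that represents the operator in the standard basis. -/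
def opSpectralRadius (T : Module.End ℝ (Matrix (Fin n) (Fin n) ℝ)) : ℝ≥0∞ :=
  spectralRadius ℂ
    ((LinearMap.toMatrix (Matrix.stdBasis ℝ (Fin n) (Fin n)) (Matrix.stdBasis ℝ (Fin n) (Fin n))
      T).map (algebraMap ℝ ℂ))

/-- Stabilizability of the pair `({A_i}, {B_i})`. -/
def Stabilizable (A : Fin r → Matrix (Fin n) (Fin n) ℝ) (B : Fin r → Matrix (Fin n) (Fin m) ℝ) :
    Prop :=
  ∃ F : Matrix (Fin m) (Fin n) ℝ, opSpectralRadius (opS A B F) < 1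

/-- Detectability of the pair `({A_i}, C)`: stabilizability of `({A_iᵀ}, {C_iᵀ})`, where `C_0 = C`
and `C_i = 0` for all other `i`. -/
def Detectable (A : Fin r → Matrix (Fin n) (Fin n) ℝ) (C : Matrix (Fin l) (Fin n) ℝ) : Prop :=
  Stabilizable (fun i => (A i)ᵀ) (fun i => if (i : ℕ) = 0 then Cᵀ else 0)

/-- `F_X = -(∑ i, B_iᵀ X B_i + R)⁻¹ (∑ i, A_iᵀ X B_i + L)ᵀ`. -/
def feedback (A : Fin r → Matrix (Fin n) (Fin n) ℝ) (B : Fin r → Matrix (Fin n) (Fin m) ℝ)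
    (L : Matrix (Fin n) (Fin m) ℝ) (R : Matrix (Fin m) (Fin m) ℝ)
    (X : Matrix (Fin n) (Fin n) ℝ) : Matrix (Fin m) (Fin n) ℝ :=
  -((∑ i, (B i)ᵀ * X * B i + R)⁻¹ * (∑ i, (A i)ᵀ * X * B i + L)ᵀ)

/-- The matrix obtained from the column of blocks `M_0, …, M_{r-1}` by the permutation of the rows
that moves row `a` of block `i` to position `(a, i)`, which is the permutation `Π` with
`Πᵀ (X ⊗ I_r) Π = I_r ⊗ X`. -/
def interleave {q : Type*} (M : Fin r → Matrix (Fin n) q ℝ) : Matrix (Fin n × Fin r) q ℝ :=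
  Matrix.of fun ai b => M ai.2 ai.1 b

/-- The matrix `A` of the standard form, with blocks `A_i - B_i R⁻¹ Lᵀ`. -/
def stdA (A : Fin r → Matrix (Fin n) (Fin n) ℝ) (B : Fin r → Matrix (Fin n) (Fin m) ℝ)
    (L : Matrix (Fin n) (Fin m) ℝ) (R : Matrix (Fin m) (Fin m) ℝ) :
    Matrix (Fin n × Fin r) (Fin n) ℝ :=
  interleave fun i => A i - B i * R⁻¹ * Lᵀ

/-- The matrix `B` of the standard form, with blocks `B_i R^{-1/2}`. -/
def stdB (B : Fin r → Matrix (Fin n) (Fin m) ℝ) (R : Matrix (Fin m) (Fin m) ℝ) :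
    Matrix (Fin n × Fin r) (Fin m) ℝ :=
  interleave fun i => B i * CFC.sqrt R⁻¹

/-- The operator `D(X) = Aᵀ ⋉ X ⋉ (I + B Bᵀ ⋉ X)⁻¹ ⋉ A + Cᵀ C` of the standard form. -/
def opD (A : Matrix (Fin n × Fin r) (Fin n) ℝ) (B : Matrix (Fin n × Fin r) (Fin m) ℝ)
    (C : Matrix (Fin l) (Fin n) ℝ) (X : Matrix (Fin n) (Fin n) ℝ) : Matrix (Fin n) (Fin n) ℝ :=
  ltimesR Aᵀ X * (1 + ltimesR (B * Bᵀ) X)⁻¹ * A + Cᵀ * C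

/-- The fixed point iteration `X_0 = 0`, `X_{t+1} = D(X_t)`. -/
def fixedPointSeq (A : Matrix (Fin n × Fin r) (Fin n) ℝ) (B : Matrix (Fin n × Fin r) (Fin m) ℝ)
    (C : Matrix (Fin l) (Fin n) ℝ) : ℕ → Matrix (Fin n) (Fin n) ℝ
  | 0 => 0
  | t + 1 => opD A B C (fixedPointSeq A B C t)

/-- `X` is a positive semidefinite stabilizing solution of the standard form `X = D(X)`. -/
structure IsPSDStabilizingSolution (A : Fin r → Matrix (Fin n) (Fin n) ℝ)
    (B : Fin r → Matrix (Fin n) (Fin m) ℝ) (L : Matrix (Fin n) (Fin m) ℝ)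
    (R : Matrix (Fin m) (Fin m) ℝ) (C : Matrix (Fin l) (Fin n) ℝ)
    (X : Matrix (Fin n) (Fin n) ℝ) : Prop where
  posSemidef : X.PosSemidef
  eq_opD : X = opD (stdA A B L R) (stdB B R) C X
  stabilizing : opSpectralRadius (opS A B (feedback A B L R X)) < 1

end Operators

section Doubling

/-- An index type with `r ^ (2 ^ k)` elements. -/
def Idx (r : ℕ) : ℕ → Type
  | 0 => Fin r
  | k + 1 => Idx r k × Idx r k

instance instFintypeIdx (r : ℕ) : (k : ℕ) → Fintype (Idx r k)
  | 0 => inferInstanceAs (Fintype (Fin r))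
  | k + 1 =>
    letI := instFintypeIdx r k
    inferInstanceAs (Fintype (Idx r k × Idx r k))

instance instDecidableEqIdx (r : ℕ) : (k : ℕ) → DecidableEq (Idx r k)
  | 0 => inferInstanceAs (DecidableEq (Fin r))
  | k + 1 =>
    letI := instDecidableEqIdx r k
    inferInstanceAs (DecidableEq (Idx r k × Idx r k))

theorem card_Idx (r k : ℕ) : Fintype.card (Idx r k) = r ^ 2 ^ k := by
  induction k with
  | zero => exact (Fintype.card_fin r).trans (by simp)
  | succ k ih =>
    have h : Fintype.card (Idx r (k + 1)) = Fintype.card (Idx r k) * Fintype.card (Idx r k) :=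
      Fintype.card_prod (Idx r k) (Idx r k)
    rw [h, ih, ← pow_add]
    congr 1
    ring

/-- A triple `(A, G, H)` of sizes `ns × n`, `ns × ns` and `n × n`, where `ι` has `s` elements. -/
@[ext]
structure Triple (n : ℕ) (ι : Type) where
  A : Matrix (Fin n × ι) (Fin n) ℝ
  G : Matrix (Fin n × ι) (Fin n × ι) ℝ
  H : Matrix (Fin n) (Fin n) ℝ

/-- One doubling step, with `W = (I + G ⋉ H)⁻¹`:
`A' = A ⋉ W ⋉ A`, `G' = G ⊗ I + A ⋉ W ⋉ G ⋉ Aᵀ`, `H' = H + Aᵀ ⋉ H ⋉ W ⋉ A`. -/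
def Triple.step {n : ℕ} {ι : Type} [Fintype ι] [DecidableEq ι] (T : Triple n ι) :
    Triple n (ι × ι) where
  A := Matrix.reindex (Equiv.prodAssoc (Fin n) ι ι) (Equiv.refl (Fin n))
    (ltimesL T.A ((1 + ltimesR T.G T.H)⁻¹ * T.A))
  G := Matrix.reindex (Equiv.prodAssoc (Fin n) ι ι) (Equiv.prodAssoc (Fin n) ι ι)
    (T.G ⊗ₖ (1 : Matrix ι ι ℝ) +
      ltimesR (ltimesL T.A ((1 + ltimesR T.G T.H)⁻¹ * T.G)) T.Aᵀ)
  H := T.H + ltimesR T.Aᵀ T.H * (1 + ltimesR T.G T.H)⁻¹ * T.A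

/-- The doubling iteration `(A_k, G_k, H_k)` with `A_0 = A`, `G_0 = B Bᵀ`, `H_0 = Cᵀ C`. -/
def doublingSeq {n m l r : ℕ} (A : Matrix (Fin n × Fin r) (Fin n) ℝ)
    (B : Matrix (Fin n × Fin r) (Fin m) ℝ) (C : Matrix (Fin l) (Fin n) ℝ) :
    (k : ℕ) → Triple n (Idx r k)
  | 0 => { A := A, G := B * Bᵀ, H := Cᵀ * C }
  | k + 1 => (doublingSeq A B C k).step

end Doubling

end SDARE

end

/-!
The doubling iteration computes every `2 ^ k`-th term of the fixed point iteration: a triple `(A,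
G, H)` encodes the map `X ↦ H + Aᵀ ⋉ X ⋉ (I + G ⋉ X)⁻¹ ⋉ A` (`Triple.riccati`), a doubling step
composes this map with itself (`Triple.riccati_step`, by elimination in two coupled linear
systems), and `H` is its value at `0`. Hence `H_k = X_{2 ^ k}` (`doublingSeq_spec`), and
everything is reduced to the fixed point iteration of `D = opD`.

Completing the square (`cost_eq`, `opD_add_eq`) writes `D(X)` as the minimum over all gains `K` of
`S_K^*(X) + Kᵀ K + Cᵀ C`, so `D` is monotone. The substitution `K = R^{1/2} (F + R⁻¹ Lᵀ)` turns
the feedback `F_X` into the minimizing gain (`closedLoop_eq`, `gain_eq_of_feedback`). A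
stabilizing gain bounds the iteration, which therefore increases to a fixed point `X⋆`
(`exists_fixedPoint`). Detectability provides a Lyapunov certificate for the closed loop at `X⋆`
(`stable_of_detectable`), and any positive semidefinite fixed point lies below `X⋆` because their
difference is dominated by its images under the powers of a stable positive operator
(`le_of_fixedPoint`); it lies above `X⋆` because it bounds the iteration started at `0`.

For the rate let `E_t = X⋆ - X_t` and let `S` be the closed-loop operator `S_{F⋆}^*`. Minimality
gives `S(E_t) ≤ E_{t+1}`, and the square that was completed is of second order, which gives
`E_{t+1} ≤ (1 + β tr E_t) S(E_t)` (`opD_sub_le`). Stability of `S` makes `tr E_t` summable, so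
that `S^t(X⋆) ≤ E_t ≤ c S^t(X⋆)` for a constant `c` (`pow_le_error`, `exists_error_le`). A matrix
`Y` with `X⋆ (I - Y X⋆)⁻¹ = c X⋆` is read off from a diagonalization of `X⋆`. Finally `a_t = tr
S^t(X⋆)` satisfies `a_{2t} ≤ κ a_t²`, because `S^t(X⋆) ≤ X⋆` implies `S^t(X⋆) ≤ κ a_t X⋆`; so `(κ
a_{2^k})^{1/2^k}` decreases and converges, to a limit that Gelfand's formula bounds by the
spectral radius (`exists_rate`).
-/

noncomputable section

namespace SDARE

/-! ### The order on symmetric matrices -/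

section Positivity

theorem transpose_eq_of_nonneg {n : Type*} {P : Matrix n n ℝ} (hP : 0 ≤ P) : Pᵀ = P := by
  rw [Matrix.nonneg_iff_posSemidef] at hP
  simpa [conjTranspose_eq_transpose_of_trivial] using hP.1.eq

theorem posDef_one_add {n : Type*} [DecidableEq n] {P : Matrix n n ℝ} (hP : 0 ≤ P) :
    (1 + P).PosDef :=
  PosDef.one.add_posSemidef (Matrix.nonneg_iff_posSemidef.mp hP)

variable {n m : Type*} [Fintype n] [Fintype m]

theorem transpose_mul_mul_nonneg {P : Matrix n n ℝ} (hP : 0 ≤ P) (M : Matrix n m ℝ) :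
    0 ≤ Mᵀ * P * M := by
  rw [Matrix.nonneg_iff_posSemidef] at *
  simpa [conjTranspose_eq_transpose_of_trivial] using hP.conjTranspose_mul_mul_same M

theorem mul_mul_transpose_nonneg {P : Matrix n n ℝ} (hP : 0 ≤ P) (M : Matrix m n ℝ) :
    0 ≤ M * P * Mᵀ := by
  simpa using transpose_mul_mul_nonneg hP Mᵀ

theorem transpose_mul_mul_mono {P Q : Matrix n n ℝ} (h : P ≤ Q) (M : Matrix n m ℝ) :
    Mᵀ * P * M ≤ Mᵀ * Q * M := by
  rw [← sub_nonneg] at *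
  simpa [Matrix.mul_sub, Matrix.sub_mul] using transpose_mul_mul_nonneg h M

theorem kronecker_one_mono [DecidableEq m] {P Q : Matrix n n ℝ} (h : P ≤ Q) :
    P ⊗ₖ (1 : Matrix m m ℝ) ≤ Q ⊗ₖ (1 : Matrix m m ℝ) := by
  classical
  rw [Matrix.le_iff] at *
  have := h.kronecker (PosSemidef.one (n := m) (R := ℝ))
  have h2 : (Q - P) ⊗ₖ (1 : Matrix m m ℝ) = Q ⊗ₖ 1 - P ⊗ₖ 1 := by
    ext i j
    simp [sub_mul]
  rwa [h2] at this

theorem kronecker_one_nonneg [DecidableEq m] {P : Matrix n n ℝ} (h : 0 ≤ P) :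
    0 ≤ P ⊗ₖ (1 : Matrix m m ℝ) := by
  simpa using kronecker_one_mono (m := m) h

theorem le_iff_dotProduct_mulVec_le {P Q : Matrix n n ℝ} (hP : Pᵀ = P) (hQ : Qᵀ = Q) :
    P ≤ Q ↔ ∀ x : n → ℝ, x ⬝ᵥ (P *ᵥ x) ≤ x ⬝ᵥ (Q *ᵥ x) := by
  rw [Matrix.le_iff, posSemidef_iff_dotProduct_mulVec]
  have h : (Q - P).IsHermitian := by
    rw [IsHermitian, conjTranspose_eq_transpose_of_trivial, transpose_sub, hP, hQ]
  rw [and_iff_right h]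
  simp [Matrix.sub_mulVec, dotProduct_sub]

theorem dotProduct_mulVec_mono {P Q : Matrix n n ℝ} (h : P ≤ Q) (x : n → ℝ) :
    x ⬝ᵥ (P *ᵥ x) ≤ x ⬝ᵥ (Q *ᵥ x) := by
  have := (Matrix.le_iff.mp h).dotProduct_mulVec_nonneg x
  simpa [Matrix.sub_mulVec, dotProduct_sub] using this

theorem trace_mono {P Q : Matrix n n ℝ} (h : P ≤ Q) : P.trace ≤ Q.trace := by
  have := (Matrix.le_iff.mp h).trace_nonneg
  rwa [trace_sub, sub_nonneg] at this

theorem trace_nonneg_of_nonneg {P : Matrix n n ℝ} (h : 0 ≤ P) : 0 ≤ P.trace := by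
  simpa using trace_mono h

theorem smul_le_smul_of_le {n : Type*} {P : Matrix n n ℝ} (hP : 0 ≤ P) {a b : ℝ} (h : a ≤ b) :
    a • P ≤ b • P := by
  rw [Matrix.le_iff, ← sub_smul]
  exact (Matrix.nonneg_iff_posSemidef.mp hP).smul (sub_nonneg.mpr h)

theorem smul_mono {n : Type*} {P Q : Matrix n n ℝ} (hPQ : P ≤ Q) {a : ℝ} (h : 0 ≤ a) :
    a • P ≤ a • Q := by
  rw [Matrix.le_iff, ← smul_sub]
  exact (Matrix.le_iff.mp hPQ).smul h

theorem smul_nonneg_of_nonneg {n : Type*} {P : Matrix n n ℝ} (hP : 0 ≤ P) {a : ℝ} (h : 0 ≤ a) :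
    0 ≤ a • P := by
  simpa using smul_mono hP h

variable [DecidableEq n] [DecidableEq m]

theorem exists_eq_transpose_mul_self {P : Matrix n n ℝ} (hP : 0 ≤ P) :
    ∃ S : Matrix n n ℝ, P = Sᵀ * S := by
  refine ⟨CFC.sqrt P, ?_⟩
  rw [transpose_eq_of_nonneg (CFC.sqrt_nonneg P), CFC.sqrt_mul_sqrt_self P hP]

theorem isUnit_det_one_add_mul {G P : Matrix n n ℝ} (hG : 0 ≤ G) (hP : 0 ≤ P) :
    IsUnit (1 + G * P).det := by
  obtain ⟨S, rfl⟩ := exists_eq_transpose_mul_self hG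
  rw [Matrix.mul_assoc, Matrix.det_one_add_mul_comm, ← Matrix.isUnit_iff_isUnit_det]
  have h := posDef_one_add (mul_mul_transpose_nonneg hP S)
  exact h.isUnit

/-- `P (1 + G P)⁻¹ = (1 + P G)⁻¹ (P + P G P) (1 + G P)⁻¹` is a congruence of a positive
semidefinite matrix. -/
theorem mul_inv_one_add_mul_nonneg {G P : Matrix n n ℝ} (hG : 0 ≤ G) (hP : 0 ≤ P) :
    0 ≤ P * (1 + G * P)⁻¹ := by
  have hu := isUnit_det_one_add_mul hG hP
  have hPt := transpose_eq_of_nonneg hP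
  have h1 : 0 ≤ P + Pᵀ * G * P := add_nonneg hP (transpose_mul_mul_nonneg hG P)
  have h2 := transpose_mul_mul_nonneg h1 (1 + G * P)⁻¹
  have h3 : P + Pᵀ * G * P = (1 + G * P)ᵀ * P := by
    rw [hPt, transpose_add, transpose_mul, hPt, transpose_eq_of_nonneg hG, transpose_one,
      Matrix.add_mul, Matrix.one_mul]
  have h4 : ((1 + G * P)⁻¹)ᵀ * (1 + G * P)ᵀ = 1 := by
    rw [← transpose_mul, Matrix.mul_nonsing_inv _ hu, transpose_one]
  rwa [h3, ← Matrix.mul_assoc, h4, Matrix.one_mul] at h2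

theorem inv_one_add_mul_mul_nonneg {G P : Matrix n n ℝ} (hG : 0 ≤ G) (hP : 0 ≤ P) :
    0 ≤ (1 + G * P)⁻¹ * G := by
  have h := mul_inv_one_add_mul_nonneg hP hG
  have h' := transpose_eq_of_nonneg h
  rw [← h'] at h
  rwa [transpose_mul, transpose_nonsing_inv, transpose_add, transpose_mul,
    transpose_eq_of_nonneg hG, transpose_eq_of_nonneg hP, transpose_one] at h

/-- Composition of two Riccati maps `X ↦ H + Aᵀ X (1 + G X)⁻¹ A`.  The vectors
`z = (1 + G P)⁻¹ A v` and `u = (1 + G' X)⁻¹ A' v` solve coupled linear systems. -/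
theorem riccati_comp {q : Type*}
    {A : Matrix n q ℝ} {A₂ : Matrix m n ℝ} {G H : Matrix n n ℝ} {G₂ X : Matrix m m ℝ}
    (hG : 0 ≤ G) (hH : 0 ≤ H) (hG₂ : 0 ≤ G₂) (hX : 0 ≤ X) :
    Aᵀ * (H + A₂ᵀ * X * (1 + G₂ * X)⁻¹ * A₂) *
        (1 + G * (H + A₂ᵀ * X * (1 + G₂ * X)⁻¹ * A₂))⁻¹ * A =
      Aᵀ * H * (1 + G * H)⁻¹ * A +
        (A₂ * ((1 + G * H)⁻¹ * A))ᵀ * X *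
          (1 + (G₂ + A₂ * ((1 + G * H)⁻¹ * G) * A₂ᵀ) * X)⁻¹ * (A₂ * ((1 + G * H)⁻¹ * A)) := by
  have huW := isUnit_det_one_add_mul hG hH
  have huN := isUnit_det_one_add_mul hG₂ hX
  have hWG := inv_one_add_mul_mul_nonneg hG hH
  have hG' : 0 ≤ G₂ + A₂ * ((1 + G * H)⁻¹ * G) * A₂ᵀ :=
    add_nonneg hG₂ (mul_mul_transpose_nonneg hWG A₂)
  have hu' := isUnit_det_one_add_mul hG' hX
  have hN := mul_inv_one_add_mul_nonneg hG₂ hX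
  have hP : 0 ≤ H + A₂ᵀ * X * (1 + G₂ * X)⁻¹ * A₂ := by
    rw [Matrix.mul_assoc A₂ᵀ]
    exact add_nonneg hH (transpose_mul_mul_nonneg hN A₂)
  have huP := isUnit_det_one_add_mul hG hP
  set W := (1 + G * H)⁻¹ with hW
  set A' := A₂ * (W * A) with hA'
  set U := (1 + (G₂ + A₂ * (W * G) * A₂ᵀ) * X)⁻¹ * A' with hU
  set N := (1 + G₂ * X)⁻¹ with hNdef
  set P := H + A₂ᵀ * X * N * A₂ with hPdef
  set Z := W * (A - G * A₂ᵀ * X * U) with hZ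
  have hUeq : U + G₂ * X * U + A₂ * W * G * A₂ᵀ * X * U = A' := by
    have : (1 + (G₂ + A₂ * (W * G) * A₂ᵀ) * X) * U = A' := by
      rw [hU, ← Matrix.mul_assoc, Matrix.mul_nonsing_inv _ hu', Matrix.one_mul]
    rw [← this]
    simp only [Matrix.add_mul, Matrix.one_mul, Matrix.mul_assoc]
    abel
  have hAZ : A₂ * Z = (1 + G₂ * X) * U := by
    have : A₂ * Z = A' - A₂ * W * G * A₂ᵀ * X * U := by
      simp only [hZ, hA', Matrix.mul_sub, Matrix.mul_assoc]
    rw [this, ← hUeq, Matrix.add_mul, Matrix.one_mul]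
    abel
  have hNAZ : N * (A₂ * Z) = U := by
    rw [hAZ, ← Matrix.mul_assoc, hNdef, Matrix.nonsing_inv_mul _ huN, Matrix.one_mul]
  have hPZ : P * Z = H * Z + A₂ᵀ * X * U := by
    rw [hPdef, Matrix.add_mul, Matrix.mul_assoc _ A₂, Matrix.mul_assoc _ N, hNAZ]
  have hWZ : (1 + G * H) * Z = A - G * A₂ᵀ * X * U := by
    rw [hZ, ← Matrix.mul_assoc, hW, Matrix.mul_nonsing_inv _ huW, Matrix.one_mul]
  have hZA : (1 + G * P) * Z = A := by
    rw [Matrix.add_mul, Matrix.one_mul, Matrix.mul_assoc, hPZ, Matrix.mul_add]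
    rw [Matrix.add_mul, Matrix.one_mul] at hWZ
    rw [← add_assoc, ← Matrix.mul_assoc G H Z, hWZ]
    simp only [Matrix.mul_assoc]
    abel
  have hZ' : (1 + G * P)⁻¹ * A = Z := by
    rw [← hZA, ← Matrix.mul_assoc, Matrix.nonsing_inv_mul _ huP, Matrix.one_mul]
  have hHG : H * W * G + Wᵀ = 1 := by
    have h1 : Wᵀ = (1 + H * G)⁻¹ := by
      rw [hW, transpose_nonsing_inv, transpose_add, transpose_mul, transpose_one,
        transpose_eq_of_nonneg hG, transpose_eq_of_nonneg hH]
    have h2 : H * W = Wᵀ * H := by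
      have := transpose_eq_of_nonneg (mul_inv_one_add_mul_nonneg hG hH)
      rw [← this, transpose_mul, transpose_eq_of_nonneg hH]
    have h3 := Matrix.nonsing_inv_mul _ (isUnit_det_one_add_mul hH hG)
    rw [h2, h1, Matrix.mul_assoc]
    rw [Matrix.mul_add, Matrix.mul_one, add_comm] at h3
    exact h3
  have hA't : A'ᵀ = Aᵀ * Wᵀ * A₂ᵀ := by
    simp only [hA', transpose_mul, Matrix.mul_assoc]
  rw [Matrix.mul_assoc _ _ A, hZ', Matrix.mul_assoc Aᵀ P Z, hPZ, Matrix.mul_assoc _ _ A', ← hU,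
    hA't, eq_sub_of_add_eq' hHG]
  simp only [hZ, Matrix.mul_sub, Matrix.mul_add, Matrix.sub_mul, Matrix.mul_one, Matrix.mul_assoc]
  abel

theorem transpose_mul_self_nonneg {a b : Type*} [Fintype a] [Fintype b] (M : Matrix a b ℝ) :
    0 ≤ Mᵀ * M := by
  classical
  have : (0 : Matrix a a ℝ) ≤ 1 := Matrix.nonneg_iff_posSemidef.mpr PosSemidef.one
  simpa using transpose_mul_mul_nonneg this M

theorem mul_transpose_self_nonneg {a b : Type*} [Fintype a] [Fintype b] (M : Matrix a b ℝ) :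
    0 ≤ M * Mᵀ := by
  simpa using transpose_mul_self_nonneg Mᵀ

theorem le_trace_smul_one {P : Matrix n n ℝ} (hP : 0 ≤ P) :
    P ≤ P.trace • (1 : Matrix n n ℝ) := by
  rw [le_iff_dotProduct_mulVec_le (transpose_eq_of_nonneg hP) (by simp)]
  intro x
  obtain ⟨S, rfl⟩ := exists_eq_transpose_mul_self hP
  have h1 : x ⬝ᵥ ((Sᵀ * S) *ᵥ x) = ∑ k, (∑ j, S k j * x j) ^ 2 := by
    rw [← mulVec_mulVec, dotProduct_mulVec, vecMul_transpose]
    simp [dotProduct, mulVec, sq]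
  have h2 : (Sᵀ * S).trace = ∑ k, ∑ j, S k j ^ 2 := by
    rw [Finset.sum_comm]
    simp [trace, Matrix.mul_apply, sq]
  rw [h1, h2, smul_mulVec, one_mulVec, dotProduct_smul, smul_eq_mul, Finset.sum_mul]
  refine Finset.sum_le_sum fun k _ => ?_
  refine (Finset.sum_mul_sq_le_sq_mul_sq _ _ _).trans (le_of_eq ?_)
  simp [dotProduct, sq]

/-- `P² ≤ (tr P) P`. -/
theorem mul_self_le_trace_smul {P : Matrix n n ℝ} (hP : 0 ≤ P) : P * P ≤ P.trace • P := by
  have hs : CFC.sqrt P * CFC.sqrt P = P := CFC.sqrt_mul_sqrt_self P hP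
  have h := transpose_mul_mul_mono (le_trace_smul_one hP) (CFC.sqrt P)
  rw [transpose_eq_of_nonneg (CFC.sqrt_nonneg P)] at h
  have h1 : CFC.sqrt P * P * CFC.sqrt P = P * P := by
    nth_rewrite 2 [← hs]
    rw [← Matrix.mul_assoc, hs, Matrix.mul_assoc, hs]
  rw [h1, Matrix.mul_smul, Matrix.smul_mul, Matrix.mul_one, hs] at h
  exact h

end Positivity

/-! ### Doubling as composition of Riccati maps -/

section Doubling

variable {n : ℕ} {ι : Type} [Fintype ι] [DecidableEq ι]

/-- The Riccati map `X ↦ H + Aᵀ ⋉ X ⋉ (1 + G ⋉ X)⁻¹ ⋉ A` attached to a triple `(A, G, H)`. -/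
def Triple.riccati (T : Triple n ι) (X : Matrix (Fin n) (Fin n) ℝ) :
    Matrix (Fin n) (Fin n) ℝ :=
  T.H + T.Aᵀ * (X ⊗ₖ (1 : Matrix ι ι ℝ)) * (1 + T.G * (X ⊗ₖ (1 : Matrix ι ι ℝ)))⁻¹ * T.A

theorem Triple.riccati_nonneg {T : Triple n ι} (hG : 0 ≤ T.G) (hH : 0 ≤ T.H)
    {X : Matrix (Fin n) (Fin n) ℝ} (hX : 0 ≤ X) : 0 ≤ T.riccati X := by
  unfold Triple.riccati
  rw [Matrix.mul_assoc T.Aᵀ]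
  exact add_nonneg hH
    (transpose_mul_mul_nonneg (mul_inv_one_add_mul_nonneg hG (kronecker_one_nonneg hX)) _)

theorem Triple.step_H (T : Triple n ι) : T.step.H = T.riccati T.H := rfl

theorem Triple.step_G_nonneg {T : Triple n ι} (hG : 0 ≤ T.G) (hH : 0 ≤ T.H) :
    0 ≤ T.step.G := by
  have hW := inv_one_add_mul_mul_nonneg hG (kronecker_one_nonneg (m := ι) hH)
  have h := add_nonneg (kronecker_one_nonneg (m := ι) hG)
    (mul_mul_transpose_nonneg hW (T.A ⊗ₖ (1 : Matrix ι ι ℝ)))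
  rw [Matrix.nonneg_iff_posSemidef] at h ⊢
  have h2 := h.submatrix (Equiv.prodAssoc (Fin n) ι ι).symm
  rw [← kroneckerMap_transpose, transpose_one] at h2
  exact h2

theorem Triple.riccati_kronecker_one {T : Triple n ι} (X : Matrix (Fin n) (Fin n) ℝ) :
    T.riccati X ⊗ₖ (1 : Matrix ι ι ℝ) =
      T.H ⊗ₖ (1 : Matrix ι ι ℝ) + (T.A ⊗ₖ (1 : Matrix ι ι ℝ))ᵀ *
        ((X ⊗ₖ (1 : Matrix ι ι ℝ)) ⊗ₖ (1 : Matrix ι ι ℝ)) *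
        (1 + (T.G ⊗ₖ (1 : Matrix ι ι ℝ)) * ((X ⊗ₖ (1 : Matrix ι ι ℝ)) ⊗ₖ (1 : Matrix ι ι ℝ)))⁻¹ *
        (T.A ⊗ₖ (1 : Matrix ι ι ℝ)) := by
  have h1 : (1 : Matrix ((Fin n × ι) × ι) ((Fin n × ι) × ι) ℝ) =
      (1 : Matrix (Fin n × ι) (Fin n × ι) ℝ) ⊗ₖ (1 : Matrix ι ι ℝ) := by simp
  have h2 : ∀ M : Matrix (Fin n × ι) (Fin n × ι) ℝ,
      (M ⊗ₖ (1 : Matrix ι ι ℝ))⁻¹ = M⁻¹ ⊗ₖ (1 : Matrix ι ι ℝ) := fun M => by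
    rw [Matrix.inv_kronecker, inv_one]
  rw [← mul_kronecker_mul, Matrix.mul_one, h1, ← add_kronecker, h2, ← kroneckerMap_transpose,
    transpose_one, ← mul_kronecker_mul, ← mul_kronecker_mul, ← mul_kronecker_mul]
  simp only [Matrix.mul_one, Triple.riccati, add_kronecker]

/-- The doubling step is composition of the Riccati map with itself. -/
theorem Triple.riccati_step {T : Triple n ι} (hG : 0 ≤ T.G) (hH : 0 ≤ T.H)
    {X : Matrix (Fin n) (Fin n) ℝ} (hX : 0 ≤ X) :
    T.step.riccati X = T.riccati (T.riccati X) := by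
  have key := riccati_comp (A := T.A) (A₂ := T.A ⊗ₖ (1 : Matrix ι ι ℝ)) hG
    (kronecker_one_nonneg (m := ι) hH) (kronecker_one_nonneg (m := ι) hG)
    (kronecker_one_nonneg (m := ι) (kronecker_one_nonneg (m := ι) hX))
  rw [← Triple.riccati_kronecker_one] at key
  set e := Equiv.prodAssoc (Fin n) ι ι
  set W := (1 + T.G * (T.H ⊗ₖ (1 : Matrix ι ι ℝ)))⁻¹ with hW
  have hA : T.step.A = ((T.A ⊗ₖ (1 : Matrix ι ι ℝ)) * (W * T.A)).submatrix e.symm id := rfl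
  have hGs : T.step.G = (T.G ⊗ₖ (1 : Matrix ι ι ℝ) + (T.A ⊗ₖ (1 : Matrix ι ι ℝ)) * (W * T.G) *
      (T.A ⊗ₖ (1 : Matrix ι ι ℝ))ᵀ).submatrix e.symm e.symm := by
    rw [← kroneckerMap_transpose, transpose_one]
    rfl
  have hXe : X ⊗ₖ (1 : Matrix (ι × ι) (ι × ι) ℝ) =
      ((X ⊗ₖ (1 : Matrix ι ι ℝ)) ⊗ₖ (1 : Matrix ι ι ℝ)).submatrix e.symm e.symm := by
    rw [← one_kronecker_one, ← kronecker_assoc]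
    rfl
  have hadd : ∀ S : Matrix ((Fin n × ι) × ι) ((Fin n × ι) × ι) ℝ,
      (1 : Matrix _ _ ℝ).submatrix e.symm e.symm + S.submatrix e.symm e.symm =
        (1 + S).submatrix e.symm e.symm := fun _ => rfl
  rw [Triple.riccati, Triple.step_H, hA, hGs, hXe, transpose_submatrix, submatrix_mul_equiv,
    submatrix_mul_equiv, ← submatrix_one_equiv e.symm, hadd, inv_submatrix_equiv,
    submatrix_mul_equiv, submatrix_mul_equiv, submatrix_id_id]
  have h1 : T.riccati T.H = T.H + T.Aᵀ * (T.H ⊗ₖ (1 : Matrix ι ι ℝ)) * W * T.A := rfl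
  rw [h1, add_assoc, ← key]
  rfl

variable {m l r : ℕ} (A : Matrix (Fin n × Fin r) (Fin n) ℝ) (B : Matrix (Fin n × Fin r) (Fin m) ℝ)
  (C : Matrix (Fin l) (Fin n) ℝ)

theorem opD_eq_riccati (X : Matrix (Fin n) (Fin n) ℝ) :
    opD A B C X = (doublingSeq A B C 0).riccati X :=
  add_comm _ _

theorem opD_nonneg {X : Matrix (Fin n) (Fin n) ℝ} (hX : 0 ≤ X) : 0 ≤ opD A B C X := by
  rw [opD_eq_riccati]
  exact Triple.riccati_nonneg (mul_transpose_self_nonneg B) (transpose_mul_self_nonneg C) hX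

theorem opD_zero : opD A B C 0 = Cᵀ * C := by
  simp [opD, ltimesR]

theorem fixedPointSeq_eq_iterate (t : ℕ) :
    fixedPointSeq A B C t = (opD A B C)^[t] 0 := by
  induction t with
  | zero => rfl
  | succ t ih => rw [Function.iterate_succ_apply', ← ih]; rfl

theorem fixedPointSeq_nonneg (t : ℕ) : 0 ≤ fixedPointSeq A B C t := by
  induction t with
  | zero => exact le_rfl
  | succ t ih => exact opD_nonneg A B C ih

/-- The `k`-th doubling triple encodes the `2 ^ k`-fold iterate of `opD`. -/
theorem doublingSeq_spec (k : ℕ) :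
    0 ≤ (doublingSeq A B C k).G ∧ 0 ≤ (doublingSeq A B C k).H ∧
      (∀ X, 0 ≤ X → (doublingSeq A B C k).riccati X = (opD A B C)^[2 ^ k] X) ∧
      (doublingSeq A B C k).H = fixedPointSeq A B C (2 ^ k) := by
  induction k with
  | zero =>
    refine ⟨mul_transpose_self_nonneg B, transpose_mul_self_nonneg C, fun X _ => ?_, ?_⟩
    · rw [pow_zero, Function.iterate_one, opD_eq_riccati]
    · exact (opD_zero A B C).symm
  | succ k ih =>
    obtain ⟨hG, hH, hR, hF⟩ := ih
    have hit : ∀ X, 0 ≤ X →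
        (doublingSeq A B C (k + 1)).riccati X = (opD A B C)^[2 ^ (k + 1)] X := by
      intro X hX
      have h1 := Triple.riccati_step hG hH hX
      rw [hR _ (Triple.riccati_nonneg hG hH hX), hR _ hX, ← Function.iterate_add_apply,
        ← two_mul, ← pow_succ'] at h1
      exact h1
    have hH' : (doublingSeq A B C (k + 1)).H = fixedPointSeq A B C (2 ^ (k + 1)) := by
      have h1 := Triple.step_H (doublingSeq A B C k)
      rw [hR _ hH, hF, fixedPointSeq_eq_iterate, ← Function.iterate_add_apply, ← two_mul,
        ← pow_succ', ← fixedPointSeq_eq_iterate] at h1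
      exact h1
    refine ⟨Triple.step_G_nonneg hG hH, ?_, hit, hH'⟩
    rw [hH']
    exact fixedPointSeq_nonneg A B C _

end Doubling

/-! ### Completion of the square -/

section Regulator

variable {N n m : Type*} [Fintype N] [Fintype m] [DecidableEq m]

/-- The minimizing feedback gain `-(1 + Bᵀ P B)⁻¹ Bᵀ P A` of the cost
`K ↦ Kᵀ K + (A + B K)ᵀ P (A + B K)`. -/
def optimalGain (A : Matrix N n ℝ) (B : Matrix N m ℝ) (P : Matrix N N ℝ) : Matrix m n ℝ :=
  -((1 + Bᵀ * P * B)⁻¹ * (Bᵀ * P * A))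

theorem mul_optimalGain (A : Matrix N n ℝ) (B : Matrix N m ℝ) {P : Matrix N N ℝ} (hP : 0 ≤ P) :
    (1 + Bᵀ * P * B) * optimalGain A B P = -(Bᵀ * P * A) := by
  have hu : IsUnit (1 + Bᵀ * P * B).det := by
    rw [← Matrix.isUnit_iff_isUnit_det]
    exact (posDef_one_add (transpose_mul_mul_nonneg hP B)).isUnit
  rw [optimalGain, Matrix.mul_neg, ← Matrix.mul_assoc, Matrix.mul_nonsing_inv _ hu, Matrix.one_mul]

variable [DecidableEq N]

/-- Sherman–Morrison–Woodbury for `P (1 + B Bᵀ P)⁻¹`. -/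
theorem mul_inv_one_add_eq_sub (B : Matrix N m ℝ) {P : Matrix N N ℝ} (hP : 0 ≤ P) :
    P * (1 + B * Bᵀ * P)⁻¹ = P - P * B * (1 + Bᵀ * P * B)⁻¹ * (Bᵀ * P) := by
  have hu : IsUnit (1 + Bᵀ * P * B).det := by
    rw [← Matrix.isUnit_iff_isUnit_det]
    exact (posDef_one_add (transpose_mul_mul_nonneg hP B)).isUnit
  have hu2 : IsUnit (1 + B * Bᵀ * P).det :=
    isUnit_det_one_add_mul (mul_transpose_self_nonneg B) hP
  have h1 : Bᵀ * P * (1 + B * Bᵀ * P) = (1 + Bᵀ * P * B) * (Bᵀ * P) := by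
    simp only [Matrix.mul_add, Matrix.add_mul, Matrix.mul_one, Matrix.one_mul, Matrix.mul_assoc]
  have h2 : (P - P * B * (1 + Bᵀ * P * B)⁻¹ * (Bᵀ * P)) * (1 + B * Bᵀ * P) = P := by
    rw [Matrix.sub_mul, Matrix.mul_assoc _ (Bᵀ * P), h1, ← Matrix.mul_assoc,
      Matrix.nonsing_inv_mul_cancel_right _ _ hu]
    simp only [Matrix.mul_add, Matrix.mul_one, Matrix.mul_assoc]
    abel
  calc P * (1 + B * Bᵀ * P)⁻¹
      = (P - P * B * (1 + Bᵀ * P * B)⁻¹ * (Bᵀ * P)) * (1 + B * Bᵀ * P) *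
          (1 + B * Bᵀ * P)⁻¹ := by rw [h2]
    _ = _ := Matrix.mul_nonsing_inv_cancel_right _ _ hu2

/-- Completion of the square. -/
theorem cost_eq (A : Matrix N n ℝ) (B : Matrix N m ℝ) {P : Matrix N N ℝ} (hP : 0 ≤ P)
    (K : Matrix m n ℝ) :
    Kᵀ * K + (A + B * K)ᵀ * P * (A + B * K) =
      Aᵀ * P * (1 + B * Bᵀ * P)⁻¹ * A +
        (K - optimalGain A B P)ᵀ * (1 + Bᵀ * P * B) * (K - optimalGain A B P) := by
  have h1 := mul_optimalGain A B hP
  set g := optimalGain A B P with hg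
  have hRt : (1 + Bᵀ * P * B)ᵀ = 1 + Bᵀ * P * B :=
    transpose_eq_of_nonneg (add_nonneg (Matrix.nonneg_iff_posSemidef.mpr PosSemidef.one)
      (transpose_mul_mul_nonneg hP B))
  have h2 : gᵀ * (1 + Bᵀ * P * B) = -(Aᵀ * P * B) := by
    rw [← hRt, ← transpose_mul, h1]
    simp [transpose_mul, transpose_eq_of_nonneg hP, Matrix.mul_assoc]
  have h3 : Aᵀ * P * (1 + B * Bᵀ * P)⁻¹ * A = Aᵀ * P * A + Aᵀ * P * B * g := by
    rw [Matrix.mul_assoc Aᵀ, mul_inv_one_add_eq_sub B hP, hg, optimalGain]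
    simp only [Matrix.mul_sub, Matrix.sub_mul, Matrix.mul_neg, Matrix.mul_assoc]
    abel
  have h4 : (K - g)ᵀ * (1 + Bᵀ * P * B) * (K - g) =
      Kᵀ * (1 + Bᵀ * P * B) * K + Kᵀ * (Bᵀ * P * A) + Aᵀ * P * B * K - Aᵀ * P * B * g := by
    rw [transpose_sub, Matrix.sub_mul, h2, Matrix.mul_sub, Matrix.sub_mul,
      Matrix.mul_assoc Kᵀ _ K, Matrix.sub_mul, Matrix.mul_assoc Kᵀ _ g, h1]
    simp only [Matrix.mul_neg, Matrix.neg_mul, Matrix.mul_assoc]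
    abel
  rw [h3, h4]
  simp only [transpose_add, transpose_mul, Matrix.mul_add, Matrix.add_mul, Matrix.mul_one,
    Matrix.mul_assoc]
  abel

end Regulator

/-! ### The Riccati operator as a minimum over gains -/

section Blocks

variable {n m l r : ℕ}

/-- The positive map `S ↦ ∑ i, (M i)ᵀ S (M i)`, encoded as `opSAdj` with zero-dimensional input. -/
def conjSum (M : Fin r → Matrix (Fin n) (Fin n) ℝ) :
    Module.End ℝ (Matrix (Fin n) (Fin n) ℝ) := opSAdj M (m := 0) 0 0

theorem conjSum_apply (M : Fin r → Matrix (Fin n) (Fin n) ℝ) (S : Matrix (Fin n) (Fin n) ℝ) :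
    conjSum M S = ∑ i, (M i)ᵀ * S * M i := by
  simp [conjSum, opSAdj]

theorem opSAdj_eq_conjSum (A : Fin r → Matrix (Fin n) (Fin n) ℝ)
    (B : Fin r → Matrix (Fin n) (Fin m) ℝ) (F : Matrix (Fin m) (Fin n) ℝ) :
    opSAdj A B F = conjSum fun i => A i + B i * F := by
  ext1 S
  rw [conjSum_apply]
  rfl

theorem opS_eq_conjSum (A : Fin r → Matrix (Fin n) (Fin n) ℝ)
    (B : Fin r → Matrix (Fin n) (Fin m) ℝ) (F : Matrix (Fin m) (Fin n) ℝ) :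
    opS A B F = conjSum fun i => (A i + B i * F)ᵀ := by
  ext1 S
  simp [conjSum_apply, opS]

theorem conjSum_nonneg (M : Fin r → Matrix (Fin n) (Fin n) ℝ) {S : Matrix (Fin n) (Fin n) ℝ}
    (hS : 0 ≤ S) : 0 ≤ conjSum M S := by
  rw [conjSum_apply]
  exact Finset.sum_nonneg fun i _ => transpose_mul_mul_nonneg hS (M i)

theorem conjSum_mono (M : Fin r → Matrix (Fin n) (Fin n) ℝ) {S T : Matrix (Fin n) (Fin n) ℝ}
    (h : S ≤ T) : conjSum M S ≤ conjSum M T := by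
  rw [← sub_nonneg, ← map_sub]
  exact conjSum_nonneg M (sub_nonneg.mpr h)

theorem interleave_transpose_mul_mul {p q : Type*} (M : Fin r → Matrix (Fin n) p ℝ)
    (N : Fin r → Matrix (Fin n) q ℝ) (S : Matrix (Fin n) (Fin n) ℝ) :
    (interleave M)ᵀ * (S ⊗ₖ (1 : Matrix (Fin r) (Fin r) ℝ)) * interleave N =
      ∑ i, (M i)ᵀ * S * N i := by
  ext a b
  simp only [Matrix.mul_apply, Matrix.sum_apply, interleave, transpose_apply, of_apply,
    kroneckerMap_apply, Matrix.one_apply, Fintype.sum_prod_type, Finset.sum_mul, mul_ite, mul_one,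
    mul_zero, Finset.sum_ite_eq', Finset.mem_univ, if_true]
  rw [Finset.sum_comm]

theorem interleave_add_mul (A : Fin r → Matrix (Fin n) (Fin n) ℝ)
    (B : Fin r → Matrix (Fin n) (Fin m) ℝ) (K : Matrix (Fin m) (Fin n) ℝ) :
    interleave A + interleave B * K = interleave fun i => A i + B i * K := by
  ext a b
  simp [interleave, Matrix.mul_apply]

theorem interleave_conj (A : Fin r → Matrix (Fin n) (Fin n) ℝ) (S : Matrix (Fin n) (Fin n) ℝ) :
    (interleave A)ᵀ * (S ⊗ₖ (1 : Matrix (Fin r) (Fin r) ℝ)) * interleave A = conjSum A S := by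
  rw [interleave_transpose_mul_mul, conjSum_apply]

/-- The optimal gain for the Riccati operator `opD` in the standard form. -/
def gain (A : Fin r → Matrix (Fin n) (Fin n) ℝ) (B : Fin r → Matrix (Fin n) (Fin m) ℝ)
    (X : Matrix (Fin n) (Fin n) ℝ) : Matrix (Fin m) (Fin n) ℝ :=
  optimalGain (interleave A) (interleave B) (X ⊗ₖ (1 : Matrix (Fin r) (Fin r) ℝ))

variable (A : Fin r → Matrix (Fin n) (Fin n) ℝ) (B : Fin r → Matrix (Fin n) (Fin m) ℝ)
  (C : Matrix (Fin l) (Fin n) ℝ)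

theorem opD_add_eq (K : Matrix (Fin m) (Fin n) ℝ) {X : Matrix (Fin n) (Fin n) ℝ} (hX : 0 ≤ X) :
    opD (interleave A) (interleave B) C X +
      (K - gain A B X)ᵀ *
        (1 + (interleave B)ᵀ * (X ⊗ₖ (1 : Matrix (Fin r) (Fin r) ℝ)) * interleave B) *
        (K - gain A B X) =
      conjSum (fun i => A i + B i * K) X + (Kᵀ * K + Cᵀ * C) := by
  have h := cost_eq (interleave A) (interleave B) (kronecker_one_nonneg (m := Fin r) hX) K
  rw [interleave_add_mul, interleave_conj] at h
  have h2 : conjSum (fun i => A i + B i * K) X + (Kᵀ * K + Cᵀ * C) =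
    (Kᵀ * K + conjSum (fun i => A i + B i * K) X) + Cᵀ * C := by abel
  rw [h2, h, opD, ltimesR, ltimesR, gain]
  abel

/-- `opD` is the pointwise minimum over all gains of affine monotone maps. -/
theorem opD_le (K : Matrix (Fin m) (Fin n) ℝ) {X : Matrix (Fin n) (Fin n) ℝ} (hX : 0 ≤ X) :
    opD (interleave A) (interleave B) C X ≤
      conjSum (fun i => A i + B i * K) X + (Kᵀ * K + Cᵀ * C) := by
  rw [← opD_add_eq A B C K hX]
  refine le_add_of_nonneg_right (transpose_mul_mul_nonneg ?_ _)
  exact add_nonneg (Matrix.nonneg_iff_posSemidef.mpr PosSemidef.one)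
      (transpose_mul_mul_nonneg (kronecker_one_nonneg hX) _)

theorem opD_eq {X : Matrix (Fin n) (Fin n) ℝ} (hX : 0 ≤ X) :
    opD (interleave A) (interleave B) C X =
      conjSum (fun i => A i + B i * gain A B X) X + ((gain A B X)ᵀ * gain A B X + Cᵀ * C) := by
  rw [← opD_add_eq A B C _ hX]
  simp

theorem opD_mono {X Y : Matrix (Fin n) (Fin n) ℝ} (hX : 0 ≤ X) (hXY : X ≤ Y) :
    opD (interleave A) (interleave B) C X ≤ opD (interleave A) (interleave B) C Y := by
  rw [opD_eq A B C (hX.trans hXY)]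
  exact (opD_le A B C (gain A B Y) hX).trans (add_le_add_left (conjSum_mono _ hXY) _)

theorem fixedPointSeq_mono :
    Monotone (fixedPointSeq (interleave A) (interleave B) C) := by
  refine monotone_nat_of_le_succ fun t => ?_
  induction t with
  | zero => exact fixedPointSeq_nonneg _ _ _ _
  | succ t ih => exact opD_mono A B C (fixedPointSeq_nonneg _ _ _ _) ih

/-- Lowering the weight from `X` to `Y` lowers the optimal cost by the linear closed-loop term and a
correction of second order in `X - Y`. -/
theorem opD_sub_le {X Y : Matrix (Fin n) (Fin n) ℝ} (hY : 0 ≤ Y) (hYX : Y ≤ X) {β : ℝ} (hβ0 : 0 ≤ β)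
    (hβ : interleave B * (interleave B)ᵀ ≤ β • (1 : Matrix (Fin n × Fin r) (Fin n × Fin r) ℝ)) :
    opD (interleave A) (interleave B) C X - opD (interleave A) (interleave B) C Y ≤
      (1 + β * (X - Y).trace) • conjSum (fun i => A i + B i * gain A B X) (X - Y) := by
  have hX := hY.trans hYX
  have hE : 0 ≤ X - Y := sub_nonneg.mpr hYX
  set K := gain A B X with hK
  set g := gain A B Y with hg
  set b := interleave B with hb
  set a := interleave A with ha
  set EE := (X - Y) ⊗ₖ (1 : Matrix (Fin r) (Fin r) ℝ) with hEE
  set M := a + b * K with hM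
  have hMe : M = interleave fun i => A i + B i * K := interleave_add_mul A B K
  set P := bᵀ * (Y ⊗ₖ (1 : Matrix (Fin r) (Fin r) ℝ)) * b with hP
  have hP0 : 0 ≤ P := transpose_mul_mul_nonneg (kronecker_one_nonneg hY) b
  set v := K - g with hv
  have hEEX : X ⊗ₖ (1 : Matrix (Fin r) (Fin r) ℝ) = EE + Y ⊗ₖ (1 : Matrix (Fin r) (Fin r) ℝ) := by
    rw [hEE, ← add_kronecker, sub_add_cancel]
  -- the gain mismatch is driven by the weight difference
  have hRv : (1 + P) * v = -(bᵀ * EE * M) := by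
    have h1 := mul_optimalGain a b (kronecker_one_nonneg (m := Fin r) hX)
    have h2 := mul_optimalGain a b (kronecker_one_nonneg (m := Fin r) hY)
    change _ * K = _ at h1
    change (1 + P) * g = _ at h2
    rw [hEEX] at h1
    rw [hv, Matrix.mul_sub, h2, hM]
    have h3 : (1 + P) * K = -(bᵀ * (EE + Y ⊗ₖ (1 : Matrix (Fin r) (Fin r) ℝ)) * a) -
        bᵀ * EE * b * K := by
      rw [← h1, hP]
      simp only [Matrix.mul_add, Matrix.add_mul]
      abel
    rw [h3]
    simp only [Matrix.mul_add, Matrix.add_mul, Matrix.mul_assoc]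
    abel
  have hvv : vᵀ * (1 + P) * v ≤ ((1 + P) * v)ᵀ * ((1 + P) * v) := by
    have h1 : 0 ≤ P + Pᵀ * P := add_nonneg hP0 (transpose_mul_self_nonneg P)
    have h2 := transpose_mul_mul_nonneg h1 v
    rw [transpose_eq_of_nonneg hP0] at h2
    rw [← sub_nonneg, transpose_mul, transpose_add, transpose_one, transpose_eq_of_nonneg hP0]
    convert h2 using 1
    simp only [Matrix.mul_add, Matrix.add_mul, Matrix.mul_assoc, Matrix.one_mul, Matrix.mul_one]
    abel
  have hEE0 : 0 ≤ EE := kronecker_one_nonneg hE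
  have hEE2 : EE * EE ≤ (X - Y).trace • EE := by
    have h := kronecker_one_mono (m := Fin r) (mul_self_le_trace_smul hE)
    rw [smul_kronecker] at h
    rwa [hEE, ← mul_kronecker_mul, Matrix.mul_one]
  have hw : ((1 + P) * v)ᵀ * ((1 + P) * v) ≤
      (β * (X - Y).trace) • conjSum (fun i => A i + B i * K) (X - Y) := by
    calc ((1 + P) * v)ᵀ * ((1 + P) * v) = (EE * M)ᵀ * (b * bᵀ) * (EE * M) := by
          rw [hRv]
          simp [transpose_mul, Matrix.mul_assoc]
      _ ≤ (EE * M)ᵀ * (β • 1) * (EE * M) := transpose_mul_mul_mono hβ _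
      _ = β • (Mᵀ * (EE * EE) * M) := by
          rw [transpose_mul, transpose_eq_of_nonneg hEE0]
          simp [Matrix.mul_assoc]
      _ ≤ β • (Mᵀ * ((X - Y).trace • EE) * M) :=
          smul_mono (transpose_mul_mul_mono hEE2 M) hβ0
      _ = _ := by
          rw [← interleave_conj, ← hMe, Matrix.mul_smul, Matrix.smul_mul, smul_smul]
  have h1 := opD_eq A B C hX
  have h2 := opD_add_eq A B C K hY
  rw [← hK] at h1
  have h3 : opD a b C X - opD a b C Y =
      conjSum (fun i => A i + B i * K) (X - Y) + vᵀ * (1 + P) * v := by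
    rw [h1, sub_eq_iff_eq_add, add_assoc, add_comm (vᵀ * (1 + P) * v), h2, map_sub]
    abel
  rw [h3, add_smul, one_smul]
  exact add_le_add_right (hvv.trans hw) _

end Blocks

/-! ### Reduction to the standard form -/

section Normalization

variable {n m r : ℕ}

theorem sqrt_inv_mul_sqrt_inv {R : Matrix (Fin m) (Fin m) ℝ} (hR : R.PosDef) :
    CFC.sqrt R⁻¹ * CFC.sqrt R⁻¹ = R⁻¹ :=
  CFC.sqrt_mul_sqrt_self _ (Matrix.nonneg_iff_posSemidef.mpr hR.inv.posSemidef)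

theorem isUnit_det_sqrt_inv {R : Matrix (Fin m) (Fin m) ℝ} (hR : R.PosDef) :
    IsUnit (CFC.sqrt R⁻¹).det := by
  have h : IsUnit (R⁻¹).det := (Matrix.isUnit_iff_isUnit_det _).mp hR.inv.isUnit
  rw [← sqrt_inv_mul_sqrt_inv hR, det_mul] at h
  exact isUnit_of_mul_isUnit_left h

/-- The change of feedback `K = R^{1/2} (F + R⁻¹ Lᵀ)` preserves the closed-loop matrices. -/
theorem closedLoop_eq (A : Fin r → Matrix (Fin n) (Fin n) ℝ)
    (B : Fin r → Matrix (Fin n) (Fin m) ℝ) (L : Matrix (Fin n) (Fin m) ℝ)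
    {R : Matrix (Fin m) (Fin m) ℝ} (hR : R.PosDef) (F : Matrix (Fin m) (Fin n) ℝ) (i : Fin r) :
    (A i - B i * R⁻¹ * Lᵀ) + (B i * CFC.sqrt R⁻¹) * ((CFC.sqrt R⁻¹)⁻¹ * (F + R⁻¹ * Lᵀ)) =
      A i + B i * F := by
  rw [Matrix.mul_assoc (B i) (CFC.sqrt R⁻¹), Matrix.mul_nonsing_inv_cancel_left _ _
    (isUnit_det_sqrt_inv hR), Matrix.mul_add, ← Matrix.mul_assoc]
  abel

/-- The feedback attached to `X` corresponds to the optimal gain of the standard form. -/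
theorem gain_eq_of_feedback (A : Fin r → Matrix (Fin n) (Fin n) ℝ)
    (B : Fin r → Matrix (Fin n) (Fin m) ℝ) (L : Matrix (Fin n) (Fin m) ℝ)
    {R : Matrix (Fin m) (Fin m) ℝ} (hR : R.PosDef) {X : Matrix (Fin n) (Fin n) ℝ} (hX : 0 ≤ X) :
    (CFC.sqrt R⁻¹)⁻¹ * (feedback A B L R X + R⁻¹ * Lᵀ) =
      gain (fun i => A i - B i * R⁻¹ * Lᵀ) (fun i => B i * CFC.sqrt R⁻¹) X := by
  set s := CFC.sqrt R⁻¹ with hs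
  have hst : sᵀ = s := transpose_eq_of_nonneg (CFC.sqrt_nonneg _)
  have hss : s * s = R⁻¹ := sqrt_inv_mul_sqrt_inv hR
  have hsu : IsUnit s.det := isUnit_det_sqrt_inv hR
  have hRu : IsUnit R.det := (Matrix.isUnit_iff_isUnit_det _).mp hR.isUnit
  have hsinv : s⁻¹ = s * R := by
    refine Matrix.inv_eq_right_inv ?_
    rw [← Matrix.mul_assoc, hss, Matrix.nonsing_inv_mul _ hRu]
  set S := ∑ i, (B i)ᵀ * X * B i with hS
  set W := ∑ i, (B i)ᵀ * X * A i with hW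
  have hS0 : 0 ≤ S := Finset.sum_nonneg fun i _ => transpose_mul_mul_nonneg hX (B i)
  have hSu : IsUnit (S + R).det :=
    (Matrix.isUnit_iff_isUnit_det _).mp
      (hR.posSemidef_add (Matrix.nonneg_iff_posSemidef.mp hS0)).isUnit
  have hF : (S + R) * feedback A B L R X = -(W + Lᵀ) := by
    rw [feedback, Matrix.mul_neg, Matrix.mul_nonsing_inv_cancel_left _ _ hSu, transpose_add,
      transpose_sum]
    simp only [transpose_mul, transpose_transpose, transpose_eq_of_nonneg hX, ← Matrix.mul_assoc,
      hW]
  set a := interleave fun i => A i - B i * R⁻¹ * Lᵀ with ha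
  set b := interleave fun i => B i * s with hb
  set XX := X ⊗ₖ (1 : Matrix (Fin r) (Fin r) ℝ) with hXX
  have hXX0 : 0 ≤ XX := kronecker_one_nonneg hX
  have h1 : bᵀ * XX * b = s * S * s := by
    rw [hb, interleave_transpose_mul_mul, hS, Matrix.mul_sum, Matrix.sum_mul]
    simp only [transpose_mul, hst, Matrix.mul_assoc]
  have h2 : bᵀ * XX * a = s * (W - S * R⁻¹ * Lᵀ) := by
    rw [hb, ha, interleave_transpose_mul_mul, hS, hW, Matrix.sum_mul, Matrix.sum_mul,
      ← Finset.sum_sub_distrib, Matrix.mul_sum]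
    simp only [transpose_mul, hst, Matrix.mul_assoc, Matrix.mul_sub]
  have hu : IsUnit (1 + bᵀ * XX * b).det :=
    (Matrix.isUnit_iff_isUnit_det _).mp (posDef_one_add (transpose_mul_mul_nonneg hXX0 b)).isUnit
  have h3 : (1 + bᵀ * XX * b) * (s⁻¹ * (feedback A B L R X + R⁻¹ * Lᵀ)) =
      -(bᵀ * XX * a) := by
    have h4 : (1 + bᵀ * XX * b) * s⁻¹ = s * (S + R) := by
      rw [h1, Matrix.add_mul, Matrix.one_mul, Matrix.mul_nonsing_inv_cancel_right _ _ hsu, hsinv,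
        Matrix.mul_add, add_comm]
    rw [← Matrix.mul_assoc, h4, h2, Matrix.mul_assoc, Matrix.mul_add, hF, ← Matrix.mul_neg]
    congr 1
    rw [← Matrix.mul_assoc, Matrix.add_mul S R, Matrix.mul_nonsing_inv _ hRu, Matrix.add_mul,
      Matrix.one_mul]
    abel
  rw [gain, optimalGain, ← Matrix.mul_neg, ← h3, Matrix.nonsing_inv_mul_cancel_left _ _ hu]

end Normalization

/-! ### Spectral radius and decay of orbits -/

section Spectral

variable {n m r : ℕ}

/-- The complex matrix of a linear operator on `ℝ^{n × n}` in the standard basis. -/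
def opMatrix (T : Module.End ℝ (Matrix (Fin n) (Fin n) ℝ)) :
    Matrix (Fin n × Fin n) (Fin n × Fin n) ℂ :=
  (LinearMap.toMatrix (Matrix.stdBasis ℝ (Fin n) (Fin n)) (Matrix.stdBasis ℝ (Fin n) (Fin n))
      T).map (algebraMap ℝ ℂ)

theorem opMatrix_apply (T : Module.End ℝ (Matrix (Fin n) (Fin n) ℝ)) (p q : Fin n × Fin n) :
    opMatrix T p q = ((T (Matrix.single q.1 q.2 1) p.1 p.2 : ℝ) : ℂ) := by
  rw [opMatrix, Matrix.map_apply, LinearMap.toMatrix_apply, stdBasis_eq_single]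
  rfl

theorem opMatrix_pow (T : Module.End ℝ (Matrix (Fin n) (Fin n) ℝ)) (t : ℕ) :
    opMatrix (T ^ t) = opMatrix T ^ t := by
  rw [opMatrix, opMatrix, ← LinearMap.toMatrix_pow, Matrix.map_pow]

theorem apply_eq_sum_single (T : Module.End ℝ (Matrix (Fin n) (Fin n) ℝ))
    (S : Matrix (Fin n) (Fin n) ℝ) (a b : Fin n) :
    T S a b = ∑ q : Fin n × Fin n, T (Matrix.single q.1 q.2 1) a b * S q.1 q.2 := by
  conv_lhs => rw [matrix_eq_sum_single S]
  rw [Fintype.sum_prod_type]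
  simp only [map_sum, Matrix.sum_apply]
  refine Finset.sum_congr rfl fun i _ => Finset.sum_congr rfl fun j _ => ?_
  have : Matrix.single i j (S i j) = S i j • Matrix.single i j (1 : ℝ) := by
    simp [Matrix.smul_single]
  rw [this, map_smul, Matrix.smul_apply, smul_eq_mul, mul_comm]

theorem opSpectralRadius_opS (A : Fin r → Matrix (Fin n) (Fin n) ℝ)
    (B : Fin r → Matrix (Fin n) (Fin m) ℝ) (F : Matrix (Fin m) (Fin n) ℝ) :
    opSpectralRadius (opS A B F) = opSpectralRadius (opSAdj A B F) := by
  have h : opMatrix (opS A B F) = (opMatrix (opSAdj A B F))ᵀ := by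
    ext p q
    rw [transpose_apply, opMatrix_apply, opMatrix_apply]
    have := trace_opS_eq_trace_opSAdj A B F (Matrix.single q.1 q.2 1) (Matrix.single p.1 p.2 1)
    simp only [Matrix.trace_mul_single, Matrix.transpose_single, Matrix.trace_single_mul] at this
    simpa using this
  change spectralRadius ℂ (opMatrix _) = spectralRadius ℂ (opMatrix _)
  have hs : spectrum ℂ (opMatrix (opS A B F)) = spectrum ℂ (opMatrix (opSAdj A B F)) := by
    ext z
    rw [h, spectrum.mem_iff, spectrum.mem_iff, ← Matrix.isUnit_transpose, transpose_sub,
      transpose_transpose]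
    simp [Matrix.algebraMap_eq_diagonal]
  rw [spectralRadius, spectralRadius, hs]

open scoped Matrix.Norms.Operator in
/-- By Gelfand's formula, orbits of `T` decay at every rate above the spectral radius. -/
theorem exists_abs_pow_apply_le {T : Module.End ℝ (Matrix (Fin n) (Fin n) ℝ)} {q : ℝ≥0}
    (hq : opSpectralRadius T < q) (S : Matrix (Fin n) (Fin n) ℝ) :
    ∃ c : ℝ, 0 ≤ c ∧ ∀ (t : ℕ) (a b : Fin n), |(T ^ t) S a b| ≤ c * (q : ℝ) ^ t := by
  have hq0 : 0 < q := by
    have := pos_of_gt hq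
    exact_mod_cast this
  have hG := spectrum.pow_nnnorm_pow_one_div_tendsto_nhds_spectralRadius (opMatrix T)
  have hev := (hG.eventually (gt_mem_nhds hq)).and (eventually_ge_atTop 1)
  obtain ⟨t₀, ht₀⟩ := eventually_atTop.mp hev
  have hlarge : ∀ t, t₀ ≤ t → ‖opMatrix T ^ t‖ ≤ (q : ℝ) ^ t := by
    intro t ht
    obtain ⟨h1, h2⟩ := ht₀ t ht
    have ht0 : (t : ℝ) ≠ 0 := by positivity
    have h3 := ENNReal.rpow_le_rpow h1.le (Nat.cast_nonneg (α := ℝ) t)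
    rw [← ENNReal.rpow_mul, one_div_mul_cancel ht0, ENNReal.rpow_one, ENNReal.rpow_natCast] at h3
    exact_mod_cast h3
  set s := ∑ p : Fin n × Fin n, |S p.1 p.2| with hs
  have hs0 : 0 ≤ s := Finset.sum_nonneg fun _ _ => abs_nonneg _
  have hent : ∀ (t : ℕ) (a b : Fin n), |(T ^ t) S a b| ≤ ‖opMatrix T ^ t‖ * s := by
    intro t a b
    rw [apply_eq_sum_single, hs, Finset.mul_sum]
    refine (Finset.abs_sum_le_sum_abs _ _).trans (Finset.sum_le_sum fun p _ => ?_)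
    rw [abs_mul]
    refine mul_le_mul_of_nonneg_right ?_ (abs_nonneg _)
    have h1 : |(T ^ t) (Matrix.single p.1 p.2 1) a b| = ‖(opMatrix T ^ t) (a, b) p‖ := by
      rw [← opMatrix_pow, opMatrix_apply, Complex.norm_real, Real.norm_eq_abs]
    rw [h1, Matrix.linfty_opNorm_def]
    have h2 : ‖(opMatrix T ^ t) (a, b) p‖₊ ≤ ∑ j, ‖(opMatrix T ^ t) (a, b) j‖₊ :=
      Finset.single_le_sum (f := fun j => ‖(opMatrix T ^ t) (a, b) j‖₊)
        (fun _ _ => zero_le) (Finset.mem_univ p)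
    have h3 : ∑ j, ‖(opMatrix T ^ t) (a, b) j‖₊ ≤
        Finset.univ.sup fun i => ∑ j, ‖(opMatrix T ^ t) i j‖₊ :=
      Finset.le_sup (f := fun i => ∑ j, ‖(opMatrix T ^ t) i j‖₊) (Finset.mem_univ (a, b))
    exact_mod_cast h2.trans h3
  refine ⟨(1 + ∑ u ∈ Finset.range t₀, ‖opMatrix T ^ u‖ / (q : ℝ) ^ u) * s, ?_, fun t a b => ?_⟩
  · positivity
  refine (hent t a b).trans ?_
  rw [mul_right_comm]
  refine mul_le_mul_of_nonneg_right ?_ hs0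
  have hqt : (0 : ℝ) < (q : ℝ) ^ t := by positivity
  rcases le_or_gt t₀ t with ht | ht
  · refine (hlarge t ht).trans (le_mul_of_one_le_left hqt.le ?_)
    exact le_add_of_nonneg_right (Finset.sum_nonneg fun _ _ => by positivity)
  · rw [← div_le_iff₀ hqt]
    refine le_add_of_nonneg_of_le zero_le_one ?_
    exact Finset.single_le_sum (f := fun u => ‖opMatrix T ^ u‖ / (q : ℝ) ^ u)
      (fun _ _ => by positivity) (Finset.mem_range.mpr ht)

open scoped Matrix.Norms.Operator in
theorem opSpectralRadius_lt_one_of_decay {T : Module.End ℝ (Matrix (Fin n) (Fin n) ℝ)} {c q : ℝ}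
    (hq0 : 0 ≤ q) (hq1 : q < 1)
    (h : ∀ (t : ℕ) (i j a b : Fin n), |(T ^ t) (Matrix.single i j 1) a b| ≤ c * q ^ t) :
    opSpectralRadius T < 1 := by
  have hnorm : ∀ t : ℕ, ‖opMatrix T ^ t‖ ≤ (Fintype.card (Fin n × Fin n)) * (|c| * q ^ t) := by
    intro t
    have hc : ∀ p p' : Fin n × Fin n, ‖(opMatrix T ^ t) p p'‖₊ ≤ Real.toNNReal (|c| * q ^ t) := by
      intro p p'
      rw [← NNReal.coe_le_coe, coe_nnnorm, ← opMatrix_pow, opMatrix_apply, Complex.norm_real,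
        Real.norm_eq_abs, Real.coe_toNNReal _ (by positivity)]
      refine (h t _ _ _ _).trans ?_
      gcongr
      exact le_abs_self c
    rw [Matrix.linfty_opNorm_def]
    have h1 : (Finset.univ.sup fun i => ∑ j, ‖(opMatrix T ^ t) i j‖₊) ≤
        (Fintype.card (Fin n × Fin n) : ℝ≥0) * Real.toNNReal (|c| * q ^ t) := by
      refine Finset.sup_le fun i _ => ?_
      refine (Finset.sum_le_sum fun j _ => hc i j).trans ?_
      simp
    have h2 := NNReal.coe_le_coe.mpr h1
    rwa [NNReal.coe_mul, Real.coe_toNNReal _ (by positivity), NNReal.coe_natCast] at h2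
  have hlim : Tendsto (fun t : ℕ => (Fintype.card (Fin n × Fin n)) * (|c| * q ^ (t + 1)) *
      ‖(1 : Matrix (Fin n × Fin n) (Fin n × Fin n) ℂ)‖) atTop (𝓝 0) := by
    have h1 := (tendsto_pow_atTop_nhds_zero_of_lt_one hq0 hq1).comp (tendsto_add_atTop_nat 1)
    simpa using ((h1.const_mul |c|).const_mul (Fintype.card (Fin n × Fin n) : ℝ)).mul_const
      ‖(1 : Matrix (Fin n × Fin n) (Fin n × Fin n) ℂ)‖
  obtain ⟨t, ht⟩ := (hlim.eventually (gt_mem_nhds one_pos)).exists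
  have h1 := spectrum.spectralRadius_le_pow_nnnorm_pow_one_div ℂ (opMatrix T) t
  refine lt_of_le_of_lt h1 ?_
  rw [← ENNReal.mul_rpow_of_nonneg _ _ (by positivity)]
  refine ENNReal.rpow_lt_one ?_ (by positivity)
  have h2 : ‖opMatrix T ^ (t + 1)‖ * ‖(1 : Matrix (Fin n × Fin n) (Fin n × Fin n) ℂ)‖ < 1 :=
    lt_of_le_of_lt (mul_le_mul_of_nonneg_right (hnorm (t + 1)) (norm_nonneg _)) ht
  exact_mod_cast h2

theorem tendsto_pow_apply_zero {T : Module.End ℝ (Matrix (Fin n) (Fin n) ℝ)}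
    (hT : opSpectralRadius T < 1) (S : Matrix (Fin n) (Fin n) ℝ) :
    Tendsto (fun t : ℕ => (T ^ t) S) atTop (𝓝 0) := by
  obtain ⟨q, hq, hq1⟩ := ENNReal.lt_iff_exists_nnreal_btwn.mp hT
  obtain ⟨c, -, hc⟩ := exists_abs_pow_apply_le hq S
  have hq1' : (q : ℝ) < 1 := by exact_mod_cast hq1
  refine tendsto_pi_nhds.mpr fun a => tendsto_pi_nhds.mpr fun b => ?_
  refine squeeze_zero_norm (fun t => hc t a b) ?_
  simpa using (tendsto_pow_atTop_nhds_zero_of_lt_one q.2 hq1').const_mul c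

end Spectral

/-! ### Stein equations and Lyapunov certificates -/

section Lyapunov

variable {n r : ℕ}

theorem nonneg_of_tendsto {ι : Type*} {f : ι → Matrix (Fin n) (Fin n) ℝ} {l : Filter ι} [l.NeBot]
    {P : Matrix (Fin n) (Fin n) ℝ} (hf : Tendsto f l (𝓝 P)) (h : ∀ᶠ i in l, 0 ≤ f i) : 0 ≤ P := by
  rw [Matrix.nonneg_iff_posSemidef, posSemidef_iff_dotProduct_mulVec]
  constructor
  · have h1 : Tendsto (fun i => (f i)ᵀ) l (𝓝 Pᵀ) :=
      (Continuous.matrix_transpose continuous_id).continuousAt.tendsto.comp hf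
    have h2 : Tendsto (fun i => (f i)ᵀ) l (𝓝 P) :=
      hf.congr' (h.mono fun i hi => (transpose_eq_of_nonneg hi).symm)
    rw [IsHermitian, conjTranspose_eq_transpose_of_trivial]
    exact tendsto_nhds_unique h1 h2
  · intro x
    have h1 : Tendsto (fun i => star x ⬝ᵥ (f i *ᵥ x)) l (𝓝 (star x ⬝ᵥ (P *ᵥ x))) := by
      have hc : Continuous fun M : Matrix (Fin n) (Fin n) ℝ => star x ⬝ᵥ (M *ᵥ x) := by fun_prop
      exact hc.continuousAt.tendsto.comp hf
    refine ge_of_tendsto h1 (h.mono fun i hi => ?_)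
    exact (Matrix.nonneg_iff_posSemidef.mp hi).dotProduct_mulVec_nonneg x

theorem le_of_tendsto_of_le {ι : Type*} {f g : ι → Matrix (Fin n) (Fin n) ℝ} {l : Filter ι}
    [l.NeBot] {P Q : Matrix (Fin n) (Fin n) ℝ} (hf : Tendsto f l (𝓝 P)) (hg : Tendsto g l (𝓝 Q))
    (h : ∀ᶠ i in l, f i ≤ g i) : P ≤ Q := by
  rw [← sub_nonneg]
  exact nonneg_of_tendsto (hg.sub hf) (h.mono fun i hi => sub_nonneg.mpr hi)

theorem conjSum_pow_nonneg (M : Fin r → Matrix (Fin n) (Fin n) ℝ) {S : Matrix (Fin n) (Fin n) ℝ}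
    (hS : 0 ≤ S) (t : ℕ) : 0 ≤ (conjSum M ^ t) S := by
  induction t with
  | zero => simpa using hS
  | succ t ih => rw [pow_succ', Module.End.mul_apply]; exact conjSum_nonneg M ih

theorem conjSum_pow_mono (M : Fin r → Matrix (Fin n) (Fin n) ℝ) {S T : Matrix (Fin n) (Fin n) ℝ}
    (h : S ≤ T) (t : ℕ) : (conjSum M ^ t) S ≤ (conjSum M ^ t) T := by
  rw [← sub_nonneg, ← map_sub]
  exact conjSum_pow_nonneg M (sub_nonneg.mpr h) t

/-- Solvability of the Stein equation `V = ∑ i, (M i)ᵀ V (M i) + W`. -/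
theorem exists_stein {M : Fin r → Matrix (Fin n) (Fin n) ℝ}
    (hM : opSpectralRadius (conjSum M) < 1) {W : Matrix (Fin n) (Fin n) ℝ} (hW : 0 ≤ W) :
    ∃ V, 0 ≤ V ∧ V = conjSum M V + W := by
  have hinj : Function.Injective (1 - conjSum M : Module.End ℝ (Matrix (Fin n) (Fin n) ℝ)) := by
    rw [← LinearMap.ker_eq_bot, LinearMap.ker_eq_bot']
    intro S hS
    have hS' : conjSum M S = S := (sub_eq_zero.mp hS).symm
    have hpow : ∀ t : ℕ, (conjSum M ^ t) S = S := by
      intro t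
      induction t with
      | zero => simp
      | succ t ih => rw [pow_succ', Module.End.mul_apply, ih, hS']
    have h := tendsto_pow_apply_zero hM S
    simp only [hpow] at h
    exact tendsto_nhds_unique tendsto_const_nhds h
  obtain ⟨V, hV⟩ := LinearMap.injective_iff_surjective.mp hinj W
  have hV' : V = conjSum M V + W := by
    rw [← hV]; simp
  refine ⟨V, ?_, hV'⟩
  have h1 : ∀ t : ℕ, 0 ≤ V - (conjSum M ^ t) V := by
    intro t
    induction t with
    | zero => simp
    | succ t ih =>
      have h2 : (conjSum M ^ t) V = (conjSum M ^ (t + 1)) V + (conjSum M ^ t) W := by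
        conv_lhs => rw [hV']
        rw [map_add, pow_succ, Module.End.mul_apply]
      have h3 : V - (conjSum M ^ (t + 1)) V = (V - (conjSum M ^ t) V) + (conjSum M ^ t) W := by
        rw [h2]; abel
      rw [h3]
      exact add_nonneg ih (conjSum_pow_nonneg M hW t)
  have h2 : Tendsto (fun t : ℕ => V - (conjSum M ^ t) V) atTop (𝓝 (V - 0)) :=
    tendsto_const_nhds.sub (tendsto_pow_apply_zero hM V)
  rw [sub_zero] at h2
  exact nonneg_of_tendsto h2 (Eventually.of_forall h1)

theorem one_nonneg_matrix : (0 : Matrix (Fin n) (Fin n) ℝ) ≤ 1 :=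
  Matrix.nonneg_iff_posSemidef.mpr PosSemidef.one

/-- A Lyapunov certificate gives a contraction rate in the order defined by `V`. -/
theorem exists_rate_of_lyapunov {M : Fin r → Matrix (Fin n) (Fin n) ℝ}
    {V : Matrix (Fin n) (Fin n) ℝ} (hV : 0 ≤ V) (h : conjSum M V ≤ V - 1) :
    ∃ q : ℝ, 0 ≤ q ∧ q < 1 ∧ conjSum M V ≤ q • V := by
  have htr := trace_nonneg_of_nonneg hV
  refine ⟨1 - 1 / (V.trace + 1), ?_, ?_, h.trans ?_⟩
  · rw [sub_nonneg, div_le_one (by positivity)]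
    linarith
  · have : 0 < 1 / (V.trace + 1) := by positivity
    linarith
  · rw [sub_smul, one_smul]
    refine sub_le_sub_left ?_ V
    have h1 : V ≤ (V.trace + 1) • (1 : Matrix (Fin n) (Fin n) ℝ) :=
      (le_trace_smul_one hV).trans (smul_le_smul_of_le one_nonneg_matrix (by linarith))
    have h2 := smul_mono h1 (a := 1 / (V.trace + 1)) (by positivity)
    rwa [smul_smul, one_div_mul_cancel (by positivity), one_smul] at h2

theorem pow_conjSum_le {M : Fin r → Matrix (Fin n) (Fin n) ℝ}
    {V : Matrix (Fin n) (Fin n) ℝ} {q : ℝ} (hq : 0 ≤ q) (h : conjSum M V ≤ q • V) (t : ℕ) :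
    (conjSum M ^ t) V ≤ q ^ t • V := by
  induction t with
  | zero => simp
  | succ t ih =>
    rw [pow_succ', Module.End.mul_apply]
    refine (conjSum_mono M ih).trans ?_
    rw [map_smul, pow_succ, mul_smul]
    exact smul_mono h (by positivity)

/-- Domination of a bilinear form by a positive semidefinite one is preserved by `conjSum`. -/
theorem abs_dotProduct_conjSum_le (M : Fin r → Matrix (Fin n) (Fin n) ℝ)
    {S P : Matrix (Fin n) (Fin n) ℝ}
    (h : ∀ x y : Fin n → ℝ, |x ⬝ᵥ (S *ᵥ y)| ≤ x ⬝ᵥ (P *ᵥ x) + y ⬝ᵥ (P *ᵥ y)) (t : ℕ)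
    (x y : Fin n → ℝ) :
    |x ⬝ᵥ ((conjSum M ^ t) S *ᵥ y)| ≤
      x ⬝ᵥ ((conjSum M ^ t) P *ᵥ x) + y ⬝ᵥ ((conjSum M ^ t) P *ᵥ y) := by
  induction t generalizing x y with
  | zero => simpa using h x y
  | succ t ih =>
    have key : ∀ (T : Matrix (Fin n) (Fin n) ℝ) (u v : Fin n → ℝ),
        u ⬝ᵥ (conjSum M T *ᵥ v) = ∑ i, (M i *ᵥ u) ⬝ᵥ (T *ᵥ (M i *ᵥ v)) := by
      intro T u v
      rw [conjSum_apply, sum_mulVec, dotProduct_sum]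
      refine Finset.sum_congr rfl fun i _ => ?_
      rw [← mulVec_mulVec, ← mulVec_mulVec, dotProduct_mulVec, vecMul_transpose]
    rw [pow_succ', Module.End.mul_apply, Module.End.mul_apply, key, key, key,
      ← Finset.sum_add_distrib]
    exact (Finset.abs_sum_le_sum_abs _ _).trans (Finset.sum_le_sum fun i _ => ih _ _)

/-- Lyapunov's criterion. -/
theorem opSpectralRadius_lt_one_of_lyapunov {M : Fin r → Matrix (Fin n) (Fin n) ℝ}
    {V : Matrix (Fin n) (Fin n) ℝ} (hV : 0 ≤ V) (h : conjSum M V ≤ V - 1) :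
    opSpectralRadius (conjSum M) < 1 := by
  obtain ⟨q, hq0, hq1, hq⟩ := exists_rate_of_lyapunov hV h
  have hV1 : 1 ≤ V := by
    have := (conjSum_nonneg M hV).trans h
    rwa [sub_nonneg] at this
  refine opSpectralRadius_lt_one_of_decay (c := V.trace + V.trace) hq0 hq1 fun t i j a b => ?_
  have h1 : ∀ x y : Fin n → ℝ, |x ⬝ᵥ ((Matrix.single i j 1 : Matrix (Fin n) (Fin n) ℝ) *ᵥ y)| ≤
      x ⬝ᵥ ((1 : Matrix (Fin n) (Fin n) ℝ) *ᵥ x) + y ⬝ᵥ ((1 : Matrix (Fin n) (Fin n) ℝ) *ᵥ y) := by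
    intro x y
    have h2 : x ⬝ᵥ ((Matrix.single i j 1 : Matrix (Fin n) (Fin n) ℝ) *ᵥ y) = x i * y j := by
      simp [Matrix.single_mulVec, dotProduct, Function.update_apply]
    have h3 : x i * x i ≤ x ⬝ᵥ x :=
      Finset.single_le_sum (f := fun k => x k * x k) (fun k _ => mul_self_nonneg _)
        (Finset.mem_univ i)
    have h4 : y j * y j ≤ y ⬝ᵥ y :=
      Finset.single_le_sum (f := fun k => y k * y k) (fun k _ => mul_self_nonneg _)
        (Finset.mem_univ j)
    rw [h2, one_mulVec, one_mulVec, abs_le]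
    constructor <;> nlinarith [sq_nonneg (x i + y j), sq_nonneg (x i - y j)]
  have h2 := abs_dotProduct_conjSum_le M h1 t (Pi.single a 1) (Pi.single b 1)
  have h3 : (conjSum M ^ t) 1 ≤ (q ^ t * V.trace) • (1 : Matrix (Fin n) (Fin n) ℝ) := by
    refine (conjSum_pow_mono M hV1 t).trans ((pow_conjSum_le hq0 hq t).trans ?_)
    rw [mul_smul]
    exact smul_mono (le_trace_smul_one hV) (by positivity)
  have h4 : ∀ a : Fin n, (Pi.single a 1 : Fin n → ℝ) ⬝ᵥ ((conjSum M ^ t) 1 *ᵥ Pi.single a 1) ≤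
      q ^ t * V.trace := by
    intro a
    refine (dotProduct_mulVec_mono h3 _).trans (le_of_eq ?_)
    simp
  have h5 : (Pi.single a 1 : Fin n → ℝ) ⬝ᵥ
      ((conjSum M ^ t) (Matrix.single i j 1) *ᵥ Pi.single b 1) =
      (conjSum M ^ t) (Matrix.single i j 1) a b := by
    simp
  rw [h5] at h2
  linarith [h4 a, h4 b]

/-- Every stable `conjSum` has a Lyapunov certificate. -/
theorem exists_lyapunov {M : Fin r → Matrix (Fin n) (Fin n) ℝ}
    (hM : opSpectralRadius (conjSum M) < 1) :
    ∃ V, 0 ≤ V ∧ 1 ≤ V ∧ conjSum M V = V - 1 := by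
  obtain ⟨V, hV, hV'⟩ := exists_stein hM one_nonneg_matrix
  refine ⟨V, hV, ?_, eq_sub_of_add_eq hV'.symm⟩
  rw [hV']
  exact le_add_of_nonneg_left (conjSum_nonneg M hV)

end Lyapunov

/-! ### Convergence of the fixed point iteration -/

section Convergence

variable {n m l r : ℕ}

/-- A bounded increasing sequence of positive semidefinite matrices converges. -/
theorem exists_tendsto_of_monotone {f : ℕ → Matrix (Fin n) (Fin n) ℝ} (hf : Monotone f)
    (h0 : 0 ≤ f 0) {Z : Matrix (Fin n) (Fin n) ℝ} (hZ : ∀ t, f t ≤ Z) :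
    ∃ X, Tendsto f atTop (𝓝 X) := by
  have hq : ∀ x : Fin n → ℝ, ∃ c, Tendsto (fun t => x ⬝ᵥ (f t *ᵥ x)) atTop (𝓝 c) := fun x =>
    ⟨_, tendsto_atTop_ciSup (fun s t hst => dotProduct_mulVec_mono (hf hst) x)
      ⟨x ⬝ᵥ (Z *ᵥ x), by rintro _ ⟨t, rfl⟩; exact dotProduct_mulVec_mono (hZ t) x⟩⟩
  choose c hc using hq
  set e : Fin n → Fin n → ℝ := fun i => Pi.single i 1 with he
  refine ⟨Matrix.of fun i j => (c (e i + e j) - c (e i) - c (e j)) / 2,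
    tendsto_pi_nhds.mpr fun i => tendsto_pi_nhds.mpr fun j => ?_⟩
  have h := (((hc (e i + e j)).sub (hc (e i))).sub (hc (e j))).div_const 2
  refine h.congr fun t => ?_
  have hs : f t j i = f t i j := by
    have h1 := transpose_eq_of_nonneg (h0.trans (hf (zero_le (a := t))))
    exact congrFun (congrFun h1 i) j
  simp only [he, mulVec_add, dotProduct_add, add_dotProduct, mulVec_single_one,
    single_one_dotProduct, col_apply, hs]
  ring

variable (A : Fin r → Matrix (Fin n) (Fin n) ℝ) (B : Fin r → Matrix (Fin n) (Fin m) ℝ)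
  (C : Matrix (Fin l) (Fin n) ℝ)

theorem continuousAt_opD {X : Matrix (Fin n) (Fin n) ℝ} (hX : 0 ≤ X) :
    ContinuousAt (opD (interleave A) (interleave B) C) X := by
  have hu : IsUnit (1 + interleave B * (interleave B)ᵀ *
      (X ⊗ₖ (1 : Matrix (Fin r) (Fin r) ℝ))).det :=
    isUnit_det_one_add_mul (mul_transpose_self_nonneg _) (kronecker_one_nonneg hX)
  have hk : Continuous fun S : Matrix (Fin n) (Fin n) ℝ =>
      S ⊗ₖ (1 : Matrix (Fin r) (Fin r) ℝ) := by
    refine continuous_pi fun p => continuous_pi fun q => ?_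
    simp only [kroneckerMap_apply]
    fun_prop
  have hinv : ContinuousAt (fun S : Matrix (Fin n) (Fin n) ℝ =>
      (1 + interleave B * (interleave B)ᵀ * (S ⊗ₖ (1 : Matrix (Fin r) (Fin r) ℝ)))⁻¹) X := by
    have h1 : Continuous fun S : Matrix (Fin n) (Fin n) ℝ =>
      (1 + interleave B * (interleave B)ᵀ * (S ⊗ₖ (1 : Matrix (Fin r) (Fin r) ℝ))) :=
      continuous_const.add (continuous_const.matrix_mul hk)
    refine ContinuousAt.comp (continuousAt_matrix_inv _ ?_) h1.continuousAt
    obtain ⟨u, hu⟩ := hu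
    rw [← hu]
    exact NormedRing.inverse_continuousAt u
  have hm : ∀ {a b c : Type} [Fintype b] {f : Matrix (Fin n) (Fin n) ℝ → Matrix a b ℝ}
      {g : Matrix (Fin n) (Fin n) ℝ → Matrix b c ℝ}, ContinuousAt f X → ContinuousAt g X →
      ContinuousAt (fun S => f S * g S) X := fun hf hg => by
    have h := (Continuous.matrix_mul continuous_fst continuous_snd).continuousAt.tendsto.comp
      (hf.tendsto.prodMk_nhds hg.tendsto)
    exact h
  unfold opD ltimesR
  exact (hm (hm (hm continuousAt_const hk.continuousAt) hinv) continuousAt_const).add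
    continuousAt_const

/-- A stabilizing gain bounds the fixed point iteration, which then increases to a fixed point. -/
theorem exists_fixedPoint {K : Matrix (Fin m) (Fin n) ℝ}
    (hK : opSpectralRadius (conjSum fun i => A i + B i * K) < 1) :
    ∃ X, 0 ≤ X ∧ X = opD (interleave A) (interleave B) C X ∧
      Tendsto (fixedPointSeq (interleave A) (interleave B) C) atTop (𝓝 X) := by
  obtain ⟨Z, hZ0, hZ⟩ := exists_stein hK
    (add_nonneg (transpose_mul_self_nonneg K) (transpose_mul_self_nonneg C))
  have hbd : ∀ t, fixedPointSeq (interleave A) (interleave B) C t ≤ Z := by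
    intro t
    induction t with
    | zero => exact hZ0
    | succ t ih =>
      refine (opD_le A B C K (fixedPointSeq_nonneg _ _ _ t)).trans ?_
      refine (add_le_add_left (conjSum_mono _ ih) _).trans (le_of_eq hZ.symm)
  obtain ⟨X, hX⟩ := exists_tendsto_of_monotone (fixedPointSeq_mono A B C) le_rfl hbd
  have hX0 : 0 ≤ X := nonneg_of_tendsto hX
    (Eventually.of_forall fun t => fixedPointSeq_nonneg _ _ _ t)
  refine ⟨X, hX0, ?_, hX⟩
  exact tendsto_nhds_unique (hX.comp (tendsto_add_atTop_nat 1))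
    ((continuousAt_opD A B C hX0).tendsto.comp hX)

theorem young_conj {p q : Type*} [Fintype p] [Fintype q] {Z : Matrix p p ℝ} (hZ : 0 ≤ Z)
    (M N : Matrix p q ℝ) {ε : ℝ} (hε : 0 < ε) :
    (M + N)ᵀ * Z * (M + N) ≤ (1 + ε) • (Mᵀ * Z * M) + (1 + 1 / ε) • (Nᵀ * Z * N) := by
  have h := smul_nonneg_of_nonneg (transpose_mul_mul_nonneg hZ (ε • M - N))
    (a := 1 / ε) (by positivity)
  rw [← sub_nonneg]
  convert h using 1
  simp only [transpose_add, transpose_sub, transpose_smul, Matrix.add_mul, Matrix.mul_add,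
    Matrix.sub_mul, Matrix.mul_sub, Matrix.smul_mul, Matrix.mul_smul, smul_sub, smul_smul,
    add_smul, one_smul]
  rw [← mul_assoc, one_div_mul_cancel hε.ne', one_mul, one_smul, one_smul]
  abel

theorem conj_le_trace_smul {p q : Type*} [Fintype p] [Fintype q] [DecidableEq p]
    {Z : Matrix p p ℝ} (hZ : 0 ≤ Z) (M : Matrix p q ℝ) :
    Mᵀ * Z * M ≤ Z.trace • (Mᵀ * M) := by
  simpa using transpose_mul_mul_mono (le_trace_smul_one hZ) M

/-- Detectability turns a positive semidefinite solution of the closed-loop Stein equation into a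
Lyapunov certificate: if `Z` certifies stability of `A i + J i C`, then `Z + c X` certifies, up to
scaling, stability of `A i + B i K`. -/
theorem stable_of_detectable {K : Matrix (Fin m) (Fin n) ℝ} (J : Fin r → Matrix (Fin n) (Fin l) ℝ)
    (hJ : opSpectralRadius (conjSum fun i => A i + J i * C) < 1) {X : Matrix (Fin n) (Fin n) ℝ}
    (hX0 : 0 ≤ X) (hX : X = conjSum (fun i => A i + B i * K) X + (Kᵀ * K + Cᵀ * C)) :
    opSpectralRadius (conjSum fun i => A i + B i * K) < 1 := by
  obtain ⟨Z, hZ0, hZ1, hZ⟩ := exists_lyapunov hJ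
  have htr := trace_nonneg_of_nonneg hZ0
  set ε : ℝ := 1 / (2 * (Z.trace + 1)) with hε
  have hε0 : 0 < ε := by positivity
  set W := Kᵀ * K + Cᵀ * C with hW
  have hKK := transpose_mul_self_nonneg K
  have hCC := transpose_mul_self_nonneg C
  set c : Fin r → ℝ := fun i => 2 * (((B i)ᵀ * Z * B i).trace + ((J i)ᵀ * Z * J i).trace) with hc
  have hpert : ∀ i, (B i * K - J i * C)ᵀ * Z * (B i * K - J i * C) ≤ c i • W := by
    intro i
    have hB := transpose_mul_mul_nonneg hZ0 (B i)
    have hJ' := transpose_mul_mul_nonneg hZ0 (J i)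
    have hB' := trace_nonneg_of_nonneg hB
    have hJ'' := trace_nonneg_of_nonneg hJ'
    have h1 := young_conj hZ0 (B i * K) (-(J i * C)) one_pos
    rw [← sub_eq_add_neg] at h1
    refine h1.trans ?_
    have h2 : (B i * K)ᵀ * Z * (B i * K) ≤ ((B i)ᵀ * Z * B i).trace • (Kᵀ * K) := by
      have := conj_le_trace_smul hB K
      simpa only [transpose_mul, Matrix.mul_assoc] using this
    have h3 : (-(J i * C))ᵀ * Z * (-(J i * C)) ≤ ((J i)ᵀ * Z * J i).trace • (Cᵀ * C) := by
      have := conj_le_trace_smul hJ' C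
      simpa only [transpose_mul, transpose_neg, Matrix.neg_mul, Matrix.mul_neg, neg_neg,
        Matrix.mul_assoc] using this
    refine (add_le_add (smul_mono h2 (by norm_num)) (smul_mono h3 (by norm_num))).trans ?_
    rw [smul_smul, smul_smul, hW, smul_add]
    refine add_le_add (smul_le_smul_of_le hKK ?_) (smul_le_smul_of_le hCC ?_) <;>
    · simp only [hc]
      linarith
  have hsplit : conjSum (fun i => A i + B i * K) Z ≤
      (1 + ε) • (Z - 1) + ((1 + 1 / ε) * ∑ i, c i) • W := by
    rw [← hZ, conjSum_apply, conjSum_apply, Finset.smul_sum, mul_smul, Finset.sum_smul,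
      Finset.smul_sum, ← Finset.sum_add_distrib]
    refine Finset.sum_le_sum fun i _ => ?_
    have h1 := young_conj hZ0 (A i + J i * C) (B i * K - J i * C) hε0
    have h2 : A i + J i * C + (B i * K - J i * C) = A i + B i * K := by abel
    rw [h2] at h1
    exact h1.trans (add_le_add_right (smul_mono (hpert i) (by positivity)) _)
  set d := (1 + 1 / ε) * ∑ i, c i with hd
  have hd0 : 0 ≤ d := by
    refine mul_nonneg (by positivity) (Finset.sum_nonneg fun i _ => ?_)
    have hB' := trace_nonneg_of_nonneg (transpose_mul_mul_nonneg hZ0 (B i))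
    have hJ'' := trace_nonneg_of_nonneg (transpose_mul_mul_nonneg hZ0 (J i))
    positivity
  -- the choice of `ε` leaves half of the margin
  have hslack : (1 + ε) • (Z - 1) ≤ Z - (1 / 2 : ℝ) • (1 : Matrix (Fin n) (Fin n) ℝ) := by
    have h1 : ε • Z ≤ (1 / 2 : ℝ) • (1 : Matrix (Fin n) (Fin n) ℝ) := by
      refine (smul_mono (le_trace_smul_one hZ0) hε0.le).trans ?_
      rw [smul_smul]
      refine smul_le_smul_of_le one_nonneg_matrix ?_
      rw [hε, div_mul_eq_mul_div, one_mul, div_le_div_iff₀ (by positivity) (by norm_num)]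
      linarith
    have h2 : 0 ≤ ε • (1 : Matrix (Fin n) (Fin n) ℝ) :=
      smul_nonneg_of_nonneg one_nonneg_matrix hε0.le
    have h3 : (Z - (1 / 2 : ℝ) • (1 : Matrix (Fin n) (Fin n) ℝ)) - (1 + ε) • (Z - 1) =
        ((1 / 2 : ℝ) • (1 : Matrix (Fin n) (Fin n) ℝ) - ε • Z) +
          ε • (1 : Matrix (Fin n) (Fin n) ℝ) := by
      module
    rw [← sub_nonneg, h3]
    exact add_nonneg (sub_nonneg.mpr h1) h2
  have hV0 : 0 ≤ (2 : ℝ) • (Z + d • X) :=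
    smul_nonneg_of_nonneg (add_nonneg hZ0 (smul_nonneg_of_nonneg hX0 hd0)) (by norm_num)
  refine opSpectralRadius_lt_one_of_lyapunov hV0 ?_
  have hSX : conjSum (fun i => A i + B i * K) X = X - W := eq_sub_of_add_eq hX.symm
  rw [map_smul, map_add, map_smul, hSX]
  have h1 := smul_mono (add_le_add_left (hsplit.trans (add_le_add_left hslack _)) (d • (X - W)))
    (a := 2) (by norm_num)
  refine h1.trans (le_of_eq ?_)
  module

/-- A fixed point with stable closed loop dominates every positive semidefinite fixed point. -/
theorem le_of_fixedPoint {X X' : Matrix (Fin n) (Fin n) ℝ} (hX0 : 0 ≤ X) (hX'0 : 0 ≤ X')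
    (hX : X = opD (interleave A) (interleave B) C X)
    (hX' : X' = opD (interleave A) (interleave B) C X')
    (hs : opSpectralRadius (conjSum fun i => A i + B i * gain A B X) < 1) : X' ≤ X := by
  set S := conjSum fun i => A i + B i * gain A B X with hS
  have h1 : X' - X ≤ S (X' - X) := by
    have h2 := opD_le A B C (gain A B X) hX'0
    have h3 := opD_eq A B C hX0
    rw [← hX'] at h2
    rw [← hX] at h3
    have h4 := sub_le_sub h2 (le_of_eq h3.symm)
    rwa [add_sub_add_right_eq_sub, ← map_sub] at h4
  have h2 : ∀ t : ℕ, X' - X ≤ (S ^ t) (X' - X) := by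
    intro t
    induction t with
    | zero => simp
    | succ t ih =>
      rw [pow_succ, Module.End.mul_apply]
      exact ih.trans (conjSum_pow_mono _ h1 t)
  have h3 := le_of_tendsto_of_le tendsto_const_nhds (tendsto_pow_apply_zero hs (X' - X))
    (Eventually.of_forall h2)
  rwa [sub_nonpos] at h3

theorem fixedPointSeq_le {X : Matrix (Fin n) (Fin n) ℝ} (hX0 : 0 ≤ X)
    (hX : X = opD (interleave A) (interleave B) C X) (t : ℕ) :
    fixedPointSeq (interleave A) (interleave B) C t ≤ X := by
  induction t with
  | zero => exact hX0
  | succ t ih =>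
    rw [hX]
    exact opD_mono A B C (fixedPointSeq_nonneg _ _ _ t) ih

variable {A B C}

/-- The error is bounded below by the linearized iteration. -/
theorem pow_le_error {X : Matrix (Fin n) (Fin n) ℝ} (hX0 : 0 ≤ X)
    (hX : X = opD (interleave A) (interleave B) C X) (t : ℕ) :
    (conjSum (fun i => A i + B i * gain A B X) ^ t) X ≤
      X - fixedPointSeq (interleave A) (interleave B) C t := by
  induction t with
  | zero => simp [fixedPointSeq]
  | succ t ih =>
    rw [pow_succ', Module.End.mul_apply]
    refine (conjSum_mono _ ih).trans ?_
    have h2 := opD_le A B C (gain A B X) (fixedPointSeq_nonneg (interleave A) (interleave B) C t)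
    have h3 := opD_eq A B C hX0
    rw [← hX] at h3
    have h4 := sub_le_sub (le_of_eq h3.symm) h2
    rwa [add_sub_add_right_eq_sub, ← map_sub] at h4

theorem error_succ_le {X : Matrix (Fin n) (Fin n) ℝ} (hX0 : 0 ≤ X)
    (hX : X = opD (interleave A) (interleave B) C X) (t : ℕ) :
    X - fixedPointSeq (interleave A) (interleave B) C (t + 1) ≤
      (1 + (interleave B * (interleave B)ᵀ).trace *
        (X - fixedPointSeq (interleave A) (interleave B) C t).trace) •
        conjSum (fun i => A i + B i * gain A B X)
          (X - fixedPointSeq (interleave A) (interleave B) C t) := by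
  have hb := mul_transpose_self_nonneg (interleave B)
  have h := opD_sub_le A B C (fixedPointSeq_nonneg _ _ _ t) (fixedPointSeq_le A B C hX0 hX t)
    (trace_nonneg_of_nonneg hb) (le_trace_smul_one hb)
  rw [← hX] at h
  exact h

/-- A sequence of matrices with `E (t + 1) ≤ (1 + β tr E t) S (E t)`, `S` stable and `E t → 0`, has
summable traces. -/
theorem summable_trace {M : Fin r → Matrix (Fin n) (Fin n) ℝ}
    (hM : opSpectralRadius (conjSum M) < 1) {E : ℕ → Matrix (Fin n) (Fin n) ℝ} (hE0 : ∀ t, 0 ≤ E t)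
    {β : ℝ} (hβ : 0 ≤ β) (hE : ∀ t, E (t + 1) ≤ (1 + β * (E t).trace) • conjSum M (E t))
    (hlim : Tendsto E atTop (𝓝 0)) : Summable fun t => (E t).trace := by
  obtain ⟨V, hV0, hV1, hV⟩ := exists_lyapunov hM
  obtain ⟨q, hq0, hq1, hq⟩ := exists_rate_of_lyapunov hV0 hV.le
  have htr0 : ∀ t, 0 ≤ (E t).trace := fun t => trace_nonneg_of_nonneg (hE0 t)
  have htr : Tendsto (fun t => (1 + β * (E t).trace) * q) atTop (𝓝 q) := by
    have h1 : Tendsto (fun t => (E t).trace) atTop (𝓝 0) := by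
      have hc : Continuous fun S : Matrix (Fin n) (Fin n) ℝ => S.trace := by fun_prop
      have h2 := hc.continuousAt.tendsto.comp hlim
      rwa [trace_zero] at h2
    simpa using ((h1.const_mul β).const_add 1).mul_const q
  obtain ⟨p, hqp, hp1⟩ := exists_between hq1
  have hp0 : 0 ≤ p := hq0.trans hqp.le
  obtain ⟨t₀, ht₀⟩ := eventually_atTop.mp (htr.eventually (gt_mem_nhds hqp))
  have hdec : ∀ s, E (s + t₀) ≤ (p ^ s * (E t₀).trace) • V := by
    intro s
    induction s with
    | zero =>
      rw [zero_add, pow_zero, one_mul]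
      exact (le_trace_smul_one (hE0 t₀)).trans (smul_mono hV1 (htr0 t₀))
    | succ s ih =>
      have h1 := hE (s + t₀)
      rw [add_right_comm] at h1
      have h2 : 0 ≤ 1 + β * (E (s + t₀)).trace := by
        have := mul_nonneg hβ (htr0 (s + t₀)); linarith
      have h3 : 0 ≤ p ^ s * (E t₀).trace := mul_nonneg (pow_nonneg hp0 s) (htr0 t₀)
      refine h1.trans ((smul_mono (conjSum_mono M ih) h2).trans ?_)
      rw [map_smul]
      refine (smul_mono (smul_mono hq h3) h2).trans ?_
      rw [smul_smul, smul_smul]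
      refine smul_le_smul_of_le hV0 ?_
      have h4 := (ht₀ (s + t₀) (Nat.le_add_left _ _)).le
      have h5 := mul_le_mul_of_nonneg_right h4 h3
      rw [pow_succ]
      linarith
  rw [← summable_nat_add_iff t₀]
  refine Summable.of_nonneg_of_le (fun s => htr0 _) (fun s => trace_mono (hdec s)) ?_
  simp only [trace_smul, smul_eq_mul]
  exact ((summable_geometric_of_lt_one hp0 hp1).mul_right _).mul_right _

/-- Up to a constant factor, the error is bounded above by the linearized iteration, since the
product of the factors `1 + β tr E t` converges. -/
theorem exists_error_le {X : Matrix (Fin n) (Fin n) ℝ} (hX0 : 0 ≤ X)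
    (hX : X = opD (interleave A) (interleave B) C X)
    (hs : opSpectralRadius (conjSum fun i => A i + B i * gain A B X) < 1)
    (hlim : Tendsto (fixedPointSeq (interleave A) (interleave B) C) atTop (𝓝 X)) :
    ∃ c : ℝ, 1 < c ∧ ∀ t, X - fixedPointSeq (interleave A) (interleave B) C t ≤
      c • (conjSum (fun i => A i + B i * gain A B X) ^ t) X := by
  set S := conjSum fun i => A i + B i * gain A B X with hS
  set E := fun t => X - fixedPointSeq (interleave A) (interleave B) C t with hE
  set β := (interleave B * (interleave B)ᵀ).trace with hβ
  have hβ0 : 0 ≤ β := trace_nonneg_of_nonneg (mul_transpose_self_nonneg _)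
  have hE0 : ∀ t, 0 ≤ E t := fun t => sub_nonneg.mpr (fixedPointSeq_le A B C hX0 hX t)
  have hEs : ∀ t, E (t + 1) ≤ (1 + β * (E t).trace) • S (E t) := fun t => error_succ_le hX0 hX t
  have htr0 : ∀ t, 0 ≤ β * (E t).trace := fun t =>
    mul_nonneg hβ0 (trace_nonneg_of_nonneg (hE0 t))
  have hElim : Tendsto E atTop (𝓝 0) := by
    have := (tendsto_const_nhds (x := X)).sub hlim
    rwa [sub_self] at this
  have hsum : Summable fun t => β * (E t).trace :=
    (summable_trace hs hE0 hβ0 hEs hElim).mul_left β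
  have hprod : ∀ t, E t ≤ (∏ s ∈ Finset.range t, (1 + β * (E s).trace)) • (S ^ t) X := by
    intro t
    induction t with
    | zero => simp [hE, fixedPointSeq]
    | succ t ih =>
      have h1 : 0 ≤ 1 + β * (E t).trace := by linarith [htr0 t]
      refine (hEs t).trans ((smul_mono (conjSum_mono _ ih) h1).trans (le_of_eq ?_))
      rw [map_smul, smul_smul, Finset.prod_range_succ, mul_comm, pow_succ', Module.End.mul_apply]
  refine ⟨Real.exp (∑' t, β * (E t).trace) + 1, by linarith [Real.exp_pos (∑' t, β * (E t).trace)],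
    fun t => (hprod t).trans (smul_le_smul_of_le (conjSum_pow_nonneg _ hX0 t) ?_)⟩
  have h1 : ∏ s ∈ Finset.range t, (1 + β * (E s).trace) ≤
      ∏ s ∈ Finset.range t, Real.exp (β * (E s).trace) := by
    refine Finset.prod_le_prod (fun s _ => by linarith [htr0 s]) fun s _ => ?_
    rw [add_comm]
    exact Real.add_one_le_exp _
  rw [← Real.exp_sum] at h1
  have h2 := Real.exp_le_exp.mpr (hsum.sum_le_tsum (Finset.range t) fun s _ => htr0 s)
  linarith

end Convergence

/-! ### Range and pseudo-inverse of a positive semidefinite matrix -/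

section Support

variable {n : ℕ}

theorem exists_diagonalization {X : Matrix (Fin n) (Fin n) ℝ} (hX : 0 ≤ X) :
    ∃ (U : Matrix (Fin n) (Fin n) ℝ) (d : Fin n → ℝ), Uᵀ * U = 1 ∧ U * Uᵀ = 1 ∧ (∀ i, 0 ≤ d i) ∧
      X = U * diagonal d * Uᵀ := by
  rw [Matrix.nonneg_iff_posSemidef] at hX
  have hU := Unitary.coe_star_mul_self hX.1.eigenvectorUnitary
  rw [star_eq_conjTranspose, conjTranspose_eq_transpose_of_trivial] at hU
  refine ⟨hX.1.eigenvectorUnitary, hX.1.eigenvalues, hU, mul_eq_one_comm.mp hU,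
    hX.eigenvalues_nonneg, ?_⟩
  have h := hX.1.spectral_theorem
  rw [Unitary.conjStarAlgAut_apply, star_eq_conjTranspose,
    conjTranspose_eq_transpose_of_trivial] at h
  exact h

theorem conj_diagonal_mul {U : Matrix (Fin n) (Fin n) ℝ} (hU : Uᵀ * U = 1) (e f : Fin n → ℝ) :
    U * diagonal e * Uᵀ * (U * diagonal f * Uᵀ) = U * diagonal (fun i => e i * f i) * Uᵀ := by
  rw [← diagonal_mul_diagonal]
  calc _ = U * diagonal e * (Uᵀ * U) * (diagonal f * Uᵀ) := by simp only [Matrix.mul_assoc]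
    _ = _ := by rw [hU]; simp only [Matrix.mul_assoc, Matrix.one_mul]

/-- A positive semidefinite matrix dominates the orthogonal projection onto its range, up to a
constant. -/
theorem exists_range_projection {X : Matrix (Fin n) (Fin n) ℝ} (hX : 0 ≤ X) :
    ∃ (Q : Matrix (Fin n) (Fin n) ℝ) (κ : ℝ), 0 < κ ∧ Qᵀ = Q ∧ Q * Q = Q ∧ X * Q = X ∧
      Q ≤ κ • X := by
  obtain ⟨U, d, hU, -, hd, rfl⟩ := exists_diagonalization hX
  have hinv : ∀ i, 0 ≤ (d i)⁻¹ := fun i => inv_nonneg.mpr (hd i)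
  refine ⟨U * diagonal (fun i => if d i = 0 then 0 else 1) * Uᵀ, 1 + ∑ i, (d i)⁻¹,
    by have := Finset.sum_nonneg (s := Finset.univ) fun i _ => hinv i; linarith, ?_, ?_, ?_, ?_⟩
  · simp [transpose_mul, Matrix.mul_assoc]
  · rw [conj_diagonal_mul hU]
    congr 3
    ext i
    split_ifs <;> simp
  · rw [conj_diagonal_mul hU]
    congr 3
    ext i
    split_ifs with h <;> simp [h]
  · rw [← Matrix.smul_mul, ← Matrix.mul_smul, ← diagonal_smul]
    have h1 : diagonal (fun i => if d i = 0 then (0 : ℝ) else 1) ≤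
        diagonal ((1 + ∑ i, (d i)⁻¹) • d) := by
      rw [Matrix.le_iff, diagonal_sub, posSemidef_diagonal_iff]
      intro i
      have h2 : (d i)⁻¹ ≤ ∑ j, (d j)⁻¹ :=
        Finset.single_le_sum (fun j _ => hinv j) (Finset.mem_univ i)
      rw [sub_nonneg, Pi.smul_apply, smul_eq_mul]
      split_ifs with h
      · simp [h]
      · have h3 := mul_le_mul_of_nonneg_right h2 (hd i)
        rw [inv_mul_cancel₀ h] at h3
        have := hd i
        linarith
    simpa using transpose_mul_mul_mono h1 Uᵀ

theorem exists_le_trace_smul_of_le {X : Matrix (Fin n) (Fin n) ℝ} (hX : 0 ≤ X) :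
    ∃ κ : ℝ, 0 < κ ∧ ∀ P, 0 ≤ P → P ≤ X → P ≤ (κ * P.trace) • X := by
  obtain ⟨Q, κ, hκ, hQt, hQQ, hXQ, hQX⟩ := exists_range_projection hX
  refine ⟨κ, hκ, fun P hP hPX => ?_⟩
  have hz : X * (1 - Q) = 0 := by rw [Matrix.mul_sub, hXQ, Matrix.mul_one, sub_self]
  obtain ⟨S, rfl⟩ := exists_eq_transpose_mul_self hP
  have hSz : S * (1 - Q) = 0 := by
    have h1 := transpose_mul_mul_mono hPX (1 - Q)
    rw [Matrix.mul_assoc _ X, hz, Matrix.mul_zero] at h1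
    have h2 := le_antisymm h1 (transpose_mul_mul_nonneg hP (1 - Q))
    rw [← Matrix.conjTranspose_mul_self_eq_zero, conjTranspose_eq_transpose_of_trivial,
      transpose_mul, ← h2]
    simp only [Matrix.mul_assoc]
  have hSQ : S * Q = S := by
    rw [Matrix.mul_sub, Matrix.mul_one, sub_eq_zero] at hSz
    exact hSz.symm
  have h3 := transpose_mul_mul_mono (le_trace_smul_one hP) Q
  have h4 : Qᵀ * (Sᵀ * S) * Q = Sᵀ * S := by
    rw [← Matrix.mul_assoc, ← transpose_mul, Matrix.mul_assoc, hSQ]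
  rw [h4, Matrix.mul_smul, Matrix.mul_one, Matrix.smul_mul, hQt, hQQ] at h3
  refine h3.trans ((smul_mono hQX (trace_nonneg_of_nonneg hP)).trans (le_of_eq ?_))
  rw [smul_smul, mul_comm]

/-- The witness `Y` is diagonal in an eigenbasis of `X`: it acts as `(1 - 1 / c) X⁻¹` on the range of
`X` and as the identity on the kernel. -/
theorem exists_posDef_mul_inv_eq_smul {X : Matrix (Fin n) (Fin n) ℝ} (hX : 0 ≤ X) {c : ℝ}
    (hc : 1 < c) :
    ∃ Y : Matrix (Fin n) (Fin n) ℝ, Y.PosDef ∧ IsUnit (1 - Y * X).det ∧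
      X * (1 - Y * X)⁻¹ = c • X := by
  obtain ⟨U, d, hU, hU', hd, rfl⟩ := exists_diagonalization hX
  have hc0 : (0 : ℝ) < c := by linarith
  set y : Fin n → ℝ := fun i => if d i = 0 then 1 else (1 - 1 / c) / d i with hy
  have hy0 : ∀ i, 0 < y i := by
    intro i
    simp only [hy]
    split_ifs with h
    · exact one_pos
    · have h1 : 0 < d i := lt_of_le_of_ne (hd i) (Ne.symm h)
      have h2 : 1 / c < 1 := by rw [div_lt_one hc0]; exact hc
      exact div_pos (by linarith) h1
  have hinj : Function.Injective (Uᵀ).mulVec := by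
    intro u v huv
    have h1 := congrArg U.mulVec huv
    simpa [mulVec_mulVec, hU'] using h1
  have hone : 1 - U * diagonal y * Uᵀ * (U * diagonal d * Uᵀ) =
      U * diagonal (fun i => 1 - y i * d i) * Uᵀ := by
    rw [conj_diagonal_mul hU, ← diagonal_sub, diagonal_one, Matrix.mul_sub, Matrix.sub_mul,
      Matrix.mul_one, hU']
  have hunit : IsUnit (1 - U * diagonal y * Uᵀ * (U * diagonal d * Uᵀ)).det := by
    rw [hone, det_mul_right_comm, hU', Matrix.one_mul, det_diagonal, isUnit_iff_ne_zero,
      Finset.prod_ne_zero_iff]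
    intro i _
    simp only [hy]
    split_ifs with h
    · simp [h]
    · rw [div_mul_cancel₀ _ h]
      have : 0 < 1 / c := by positivity
      linarith
  refine ⟨U * diagonal y * Uᵀ, ?_, hunit, ?_⟩
  · have h1 := (PosDef.diagonal hy0).conjTranspose_mul_mul_same hinj
    simpa [conjTranspose_eq_transpose_of_trivial] using h1
  · have h1 : U * diagonal d * Uᵀ =
        c • (U * diagonal d * Uᵀ) * (1 - U * diagonal y * Uᵀ * (U * diagonal d * Uᵀ)) := by
      rw [hone, Matrix.smul_mul, conj_diagonal_mul hU, ← Matrix.smul_mul, ← Matrix.mul_smul,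
        ← diagonal_smul]
      congr 3
      ext i
      simp only [Pi.smul_apply, smul_eq_mul, hy]
      split_ifs with h
      · simp [h]
      · rw [div_mul_cancel₀ _ h]
        field_simp
        ring
    nth_rewrite 1 [h1]
    rw [Matrix.mul_nonsing_inv_cancel_right _ _ hunit]

end Support

/-! ### Root test along powers of two -/

section Rate

theorem tendsto_const_rpow_inv_two_pow {c : ℝ} (hc : 0 < c) :
    Tendsto (fun k : ℕ => c ^ ((1 : ℝ) / (2 : ℝ) ^ k)) atTop (𝓝 1) := by
  have h1 : Tendsto (fun k : ℕ => (1 : ℝ) / (2 : ℝ) ^ k) atTop (𝓝 0) := by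
    simpa using tendsto_pow_atTop_nhds_zero_of_lt_one (r := (1 / 2 : ℝ)) (by norm_num) (by norm_num)
  simpa using (tendsto_const_nhds (x := c)).rpow h1 (Or.inl hc.ne')

theorem rpow_inv_two_pow_of_pow {q : ℝ} (hq : 0 ≤ q) (k : ℕ) :
    (q ^ 2 ^ k) ^ ((1 : ℝ) / (2 : ℝ) ^ k) = q := by
  rw [← Real.rpow_natCast, ← Real.rpow_mul hq]
  simp

/-- Along powers of two, the root test limit exists for a sequence with `a (2 t) ≤ κ (a t)²`, since
`(κ a (2 ^ k)) ^ (1 / 2 ^ k)` is decreasing. -/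
theorem exists_tendsto_rpow {a : ℕ → ℝ} (ha : ∀ t, 0 ≤ a t) {κ : ℝ} (hκ : 0 < κ)
    (h : ∀ t, a (2 * t) ≤ κ * a t ^ 2) :
    ∃ ℓ : ℝ≥0, Tendsto (fun k : ℕ => a (2 ^ k) ^ ((1 : ℝ) / (2 : ℝ) ^ k)) atTop (𝓝 (ℓ : ℝ)) := by
  set f : ℕ → ℝ := fun k => (κ * a (2 ^ k)) ^ ((1 : ℝ) / (2 : ℝ) ^ k) with hf
  have hpos : ∀ k, 0 ≤ κ * a (2 ^ k) := fun k => mul_nonneg hκ.le (ha _)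
  have hf0 : ∀ k, 0 ≤ f k := fun k => Real.rpow_nonneg (hpos k) _
  have hanti : Antitone f := by
    refine antitone_nat_of_succ_le fun k => ?_
    have h1 : κ * a (2 ^ (k + 1)) ≤ (κ * a (2 ^ k)) ^ 2 := by
      rw [pow_succ', mul_pow, sq κ, mul_assoc]
      exact mul_le_mul_of_nonneg_left (h _) hκ.le
    refine (Real.rpow_le_rpow (hpos (k + 1)) h1 (by positivity)).trans (le_of_eq ?_)
    rw [← Real.rpow_natCast, ← Real.rpow_mul (hpos k)]
    congr 1
    rw [pow_succ]
    push_cast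
    field_simp
  have hlim := tendsto_atTop_ciInf hanti ⟨0, by rintro _ ⟨k, rfl⟩; exact hf0 k⟩
  have hℓ0 : 0 ≤ ⨅ k, f k := le_ciInf hf0
  refine ⟨⟨⨅ k, f k, hℓ0⟩, ?_⟩
  have h2 := (tendsto_const_rpow_inv_two_pow (inv_pos.mpr hκ)).mul hlim
  rw [one_mul] at h2
  refine h2.congr fun k => ?_
  rw [hf, ← Real.mul_rpow (inv_nonneg.mpr hκ.le) (hpos k), inv_mul_cancel_left₀ hκ.ne']

theorem limit_le_of_le_geometric {a : ℕ → ℝ} (ha : ∀ t, 0 ≤ a t) {ℓ c q : ℝ} (hq : 0 ≤ q)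
    (hc : 0 ≤ c)
    (hℓ : Tendsto (fun k : ℕ => a (2 ^ k) ^ ((1 : ℝ) / (2 : ℝ) ^ k)) atTop (𝓝 ℓ))
    (h : ∀ t, a t ≤ c * q ^ t) : ℓ ≤ q := by
  have h1 := (tendsto_const_rpow_inv_two_pow (c := c + 1) (by linarith)).mul_const q
  rw [one_mul] at h1
  refine le_of_tendsto_of_tendsto' hℓ h1 fun k => ?_
  have h2 : a (2 ^ k) ≤ (c + 1) * q ^ 2 ^ k :=
    (h _).trans (mul_le_mul_of_nonneg_right (by linarith) (by positivity))
  refine (Real.rpow_le_rpow (ha _) h2 (by positivity)).trans (le_of_eq ?_)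
  rw [Real.mul_rpow (by linarith) (by positivity), rpow_inv_two_pow_of_pow hq]

theorem tendsto_rpow_of_equivalent {a b : ℕ → ℝ} (ha : ∀ k, 0 ≤ a k) {ℓ c₁ c₂ : ℝ} (h₁ : 0 < c₁)
    (h₂ : 0 < c₂) (hl : ∀ k, c₁ * a k ≤ b k) (hu : ∀ k, b k ≤ c₂ * a k)
    (h : Tendsto (fun k : ℕ => a k ^ ((1 : ℝ) / (2 : ℝ) ^ k)) atTop (𝓝 ℓ)) :
    Tendsto (fun k : ℕ => b k ^ ((1 : ℝ) / (2 : ℝ) ^ k)) atTop (𝓝 ℓ) := by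
  have hl' := (tendsto_const_rpow_inv_two_pow h₁).mul h
  have hu' := (tendsto_const_rpow_inv_two_pow h₂).mul h
  rw [one_mul] at hl' hu'
  refine tendsto_of_tendsto_of_tendsto_of_le_of_le hl' hu' (fun k => ?_) fun k => ?_
  · have h3 := mul_nonneg h₁.le (ha k)
    have := Real.rpow_le_rpow h3 (hl k) (z := (1 : ℝ) / (2 : ℝ) ^ k) (by positivity)
    rwa [Real.mul_rpow h₁.le (ha k)] at this
  · have h3 := (mul_nonneg h₁.le (ha k)).trans (hl k)
    have := Real.rpow_le_rpow h3 (hu k) (z := (1 : ℝ) / (2 : ℝ) ^ k) (by positivity)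
    rwa [Real.mul_rpow h₂.le (ha k)] at this

/-- On a finite-dimensional space every linear functional is bounded by every norm. -/
theorem exists_abs_le_seminorm {E : Type*} [AddCommGroup E] [Module ℝ E] [FiniteDimensional ℝ E]
    (N : Seminorm ℝ E) (hN : ∀ Z, N Z = 0 → Z = 0) (f : E →ₗ[ℝ] ℝ) :
    ∃ c : ℝ, 0 < c ∧ ∀ Z, |f Z| ≤ c * N Z := by
  let _ : NormedAddCommGroup E :=
    AddGroupNorm.toNormedAddCommGroup
      { toFun := N
        map_zero' := map_zero N
        add_le' := map_add_le_add N
        neg' := map_neg_eq_map N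
        eq_zero_of_map_eq_zero' := hN }
  let _ : NormedSpace ℝ E := { norm_smul_le := fun a x => (map_smul_eq_mul N a x).le }
  refine ⟨‖f.toContinuousLinearMap‖ + 1, by positivity, fun Z => ?_⟩
  have h1 := f.toContinuousLinearMap.le_opNorm Z
  have h2 : ‖Z‖ = N Z := rfl
  rw [h2] at h1
  have h3 : 0 ≤ N Z := apply_nonneg N Z
  have h4 : |f Z| ≤ ‖f.toContinuousLinearMap‖ * N Z := h1
  linarith

variable {n : ℕ}

theorem abs_apply_le_trace {P : Matrix (Fin n) (Fin n) ℝ} (hP : 0 ≤ P) (i j : Fin n) :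
    |P i j| ≤ P.trace := by
  have hd : ∀ i, 0 ≤ P i i := fun i => (Matrix.nonneg_iff_posSemidef.mp hP).diag_nonneg
  have ht : ∀ i, P i i ≤ P.trace := fun i =>
    Finset.single_le_sum (f := fun k => P k k) (fun k _ => hd k) (Finset.mem_univ i)
  have hs : P j i = P i j := congrFun (congrFun (transpose_eq_of_nonneg hP) i) j
  have h1 := dotProduct_mulVec_mono hP (Pi.single i 1 + Pi.single j 1)
  have h2 := dotProduct_mulVec_mono hP (Pi.single i 1 - Pi.single j 1)
  simp only [Matrix.zero_apply, mulVec_add, mulVec_sub, dotProduct_add, dotProduct_sub,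
    add_dotProduct, sub_dotProduct, mulVec_single_one, single_one_dotProduct, col_apply, hs]
    at h1 h2
  rw [abs_le]
  constructor <;> linarith [ht i, ht j]

theorem exists_seminorm_le_trace (N : Seminorm ℝ (Matrix (Fin n) (Fin n) ℝ)) :
    ∃ c : ℝ, 0 < c ∧ ∀ P, 0 ≤ P → N P ≤ c * P.trace := by
  have hs : 0 ≤ ∑ i, ∑ j, N (Matrix.single i j 1) :=
    Finset.sum_nonneg fun i _ => Finset.sum_nonneg fun j _ => apply_nonneg N _
  refine ⟨1 + ∑ i, ∑ j, N (Matrix.single i j 1), by linarith, fun P hP => ?_⟩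
  have h1 : N P ≤ ∑ i, ∑ j, N (Matrix.single i j (P i j)) := by
    conv_lhs => rw [matrix_eq_sum_single P]
    refine (Finset.le_sum_of_subadditive N (map_zero N).le (map_add_le_add N) _ _).trans ?_
    exact Finset.sum_le_sum fun i _ =>
      Finset.le_sum_of_subadditive N (map_zero N).le (map_add_le_add N) _ _
  have h2 : ∀ i j, N (Matrix.single i j (P i j)) ≤ P.trace * N (Matrix.single i j 1) := by
    intro i j
    have : Matrix.single i j (P i j) = P i j • Matrix.single i j (1 : ℝ) := by
      simp [Matrix.smul_single]
    rw [this, map_smul_eq_mul, Real.norm_eq_abs]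
    exact mul_le_mul_of_nonneg_right (abs_apply_le_trace hP i j) (apply_nonneg N _)
  have h3 := h1.trans (Finset.sum_le_sum fun i _ => Finset.sum_le_sum fun j _ => h2 i j)
  simp only [← Finset.mul_sum] at h3
  have h4 := trace_nonneg_of_nonneg hP
  linarith

end Rate

/-! ### The rate of convergence and the standard form -/

section StandardForm

variable {n m l r : ℕ}

/-- The limit of the relative errors, computed on the linearized iteration
`t ↦ (conjSum M ^ t) X`, which is comparable to the error. -/
theorem exists_rate {M : Fin r → Matrix (Fin n) (Fin n) ℝ} {X : Matrix (Fin n) (Fin n) ℝ}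
    (hX0 : 0 ≤ X) (hne : X ≠ 0) (hX : conjSum M X ≤ X) {E : ℕ → Matrix (Fin n) (Fin n) ℝ} {c : ℝ}
    (hc : 1 < c) (hl : ∀ t, (conjSum M ^ t) X ≤ E t) (hu : ∀ t, E t ≤ c • (conjSum M ^ t) X) :
    ∃ ℓ : ℝ≥0, (ℓ : ℝ≥0∞) ≤ opSpectralRadius (conjSum M) ∧
      ∀ N : Seminorm ℝ (Matrix (Fin n) (Fin n) ℝ), (∀ Z, N Z = 0 → Z = 0) →
        Tendsto (fun k : ℕ => (N (E (2 ^ k)) / N X) ^ ((1 : ℝ) / (2 : ℝ) ^ k)) atTop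
          (𝓝 (ℓ : ℝ)) := by
  set a : ℕ → ℝ := fun t => ((conjSum M ^ t) X).trace with ha
  have hP : ∀ t, 0 ≤ (conjSum M ^ t) X := conjSum_pow_nonneg M hX0
  have ha0 : ∀ t, 0 ≤ a t := fun t => trace_nonneg_of_nonneg (hP t)
  have hPX : ∀ t, (conjSum M ^ t) X ≤ X := by
    intro t
    induction t with
    | zero => simp
    | succ t ih =>
      rw [pow_succ', Module.End.mul_apply]
      exact (conjSum_mono M ih).trans hX
  obtain ⟨κ, hκ, hκP⟩ := exists_le_trace_smul_of_le hX0
  have hsub : ∀ t, a (2 * t) ≤ κ * a t ^ 2 := by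
    intro t
    have h1 := trace_mono (conjSum_pow_mono M (hκP _ (hP t) (hPX t)) t)
    rw [← Module.End.mul_apply, ← pow_add, ← two_mul, map_smul, trace_smul, smul_eq_mul] at h1
    calc a (2 * t) ≤ κ * a t * a t := h1
      _ = κ * a t ^ 2 := by ring
  obtain ⟨ℓ, hℓ⟩ := exists_tendsto_rpow ha0 hκ hsub
  refine ⟨ℓ, ?_, fun N hN => ?_⟩
  · by_contra! hlt
    obtain ⟨q, hq, hqℓ⟩ := ENNReal.lt_iff_exists_nnreal_btwn.mp hlt
    obtain ⟨c', hc', hbd⟩ := exists_abs_pow_apply_le hq X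
    have h1 : ∀ t, a t ≤ (n * c') * (q : ℝ) ^ t := by
      intro t
      have h2 : a t ≤ ∑ _i : Fin n, c' * (q : ℝ) ^ t :=
        Finset.sum_le_sum fun i _ => (le_abs_self _).trans (hbd t i i)
      simpa [mul_assoc] using h2
    have h2 := limit_le_of_le_geometric ha0 q.2 (by positivity) hℓ h1
    exact absurd (ENNReal.coe_lt_coe.mp hqℓ) (not_lt.mpr (NNReal.coe_le_coe.mp h2))
  · obtain ⟨c₂, hc₂, hu₂⟩ := exists_seminorm_le_trace N
    obtain ⟨c₁, hc₁, hl₁⟩ := exists_abs_le_seminorm N hN (Matrix.traceLinearMap (Fin n) ℝ ℝ)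
    have hNX : 0 < N X :=
      lt_of_le_of_ne (apply_nonneg N X) fun h => hne (hN X h.symm)
    have hE0 : ∀ t, 0 ≤ E t := fun t => (hP t).trans (hl t)
    refine tendsto_rpow_of_equivalent (c₁ := 1 / (c₁ * N X)) (c₂ := c₂ * c / N X)
      (fun k => ha0 (2 ^ k)) (by positivity) (by positivity) (fun k => ?_) (fun k => ?_) hℓ
    · have h1 := (trace_mono (hl (2 ^ k))).trans ((le_abs_self _).trans (hl₁ (E (2 ^ k))))
      rw [div_mul_eq_mul_div, one_mul, div_le_div_iff₀ (by positivity) hNX]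
      have h2 := mul_le_mul_of_nonneg_right h1 hNX.le
      calc a (2 ^ k) * N X ≤ c₁ * N (E (2 ^ k)) * N X := h2
        _ = N (E (2 ^ k)) * (c₁ * N X) := by ring
    · have h1 := trace_mono (hu (2 ^ k))
      rw [trace_smul, smul_eq_mul] at h1
      rw [div_mul_eq_mul_div]
      refine div_le_div_of_nonneg_right ?_ hNX.le
      refine (hu₂ _ (hE0 (2 ^ k))).trans ?_
      rw [mul_assoc]
      exact mul_le_mul_of_nonneg_left h1 hc₂.le

variable (A : Fin r → Matrix (Fin n) (Fin n) ℝ) (B : Fin r → Matrix (Fin n) (Fin m) ℝ)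
  (L : Matrix (Fin n) (Fin m) ℝ) {R : Matrix (Fin m) (Fin m) ℝ}

theorem conjSum_standardForm (hR : R.PosDef) (F : Matrix (Fin m) (Fin n) ℝ) :
    conjSum (fun i => (A i - B i * R⁻¹ * Lᵀ) +
      (B i * CFC.sqrt R⁻¹) * ((CFC.sqrt R⁻¹)⁻¹ * (F + R⁻¹ * Lᵀ))) = opSAdj A B F := by
  rw [opSAdj_eq_conjSum]
  congr 1
  ext1 i
  exact closedLoop_eq A B L hR F i

theorem conjSum_gain (hR : R.PosDef) {X : Matrix (Fin n) (Fin n) ℝ} (hX : 0 ≤ X) :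
    conjSum (fun i => (A i - B i * R⁻¹ * Lᵀ) + (B i * CFC.sqrt R⁻¹) *
      gain (fun i => A i - B i * R⁻¹ * Lᵀ) (fun i => B i * CFC.sqrt R⁻¹) X) =
      opSAdj A B (feedback A B L R X) := by
  rw [← gain_eq_of_feedback A B L hR hX, conjSum_standardForm A B L hR]

theorem exists_of_detectable {A : Fin r → Matrix (Fin n) (Fin n) ℝ}
    {C : Matrix (Fin l) (Fin n) ℝ} (h : Detectable A C) :
    ∃ J : Fin r → Matrix (Fin n) (Fin l) ℝ,
      opSpectralRadius (conjSum fun i => A i + J i * C) < 1 := by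
  obtain ⟨F, hF⟩ := h
  refine ⟨fun i => if (i : ℕ) = 0 then Fᵀ else 0, ?_⟩
  rw [opS_eq_conjSum] at hF
  convert hF using 4 with i
  by_cases h : (i : ℕ) = 0 <;> simp [h]

end StandardForm
end SDARE

end

open SDARE

theorem theorem2p4 (n m l r : ℕ) (hr : 1 ≤ r)
    (A : Fin r → Matrix (Fin n) (Fin n) ℝ) (B : Fin r → Matrix (Fin n) (Fin m) ℝ)
    (Q : Matrix (Fin n) (Fin n) ℝ) (L : Matrix (Fin n) (Fin m) ℝ)
    (R : Matrix (Fin m) (Fin m) ℝ) (C : Matrix (Fin l) (Fin n) ℝ)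
    (hQLR : (Matrix.fromBlocks Q L Lᵀ R).PosSemidef)
    (hR : R.PosDef)
    (hstab : SDARE.Stabilizable A B)
    (hC : Cᵀ * C = Q - L * R⁻¹ * Lᵀ)
    (hdet : SDARE.Detectable (fun i => A i - B i * R⁻¹ * Lᵀ) C)
    (T : (k : ℕ) → SDARE.Triple n (SDARE.Idx r k))
    (hT : T = SDARE.doublingSeq (SDARE.stdA A B L R) (SDARE.stdB B R) C)
    (H : ℕ → Matrix (Fin n) (Fin n) ℝ) (hH : H = fun k => (T k).H) :
    (∀ k, IsUnit (1 + SDARE.ltimesR (T k).G (T k).H).det) ∧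
    ∃ X : Matrix (Fin n) (Fin n) ℝ,
      SDARE.IsPSDStabilizingSolution A B L R C X ∧
      (∀ X', SDARE.IsPSDStabilizingSolution A B L R C X' → X' = X) ∧
      (∀ k, (H (k + 1) - H k).PosSemidef) ∧
      ((∃ K, (∀ k, K ≤ k → H k = X) ∧ ∀ k, k < K → H (k + 1) ≠ H k) ∨
        ∀ k, H (k + 1) ≠ H k) ∧
      Tendsto H atTop (𝓝 X) ∧
      (∃ Y : Matrix (Fin n) (Fin n) ℝ, Y.PosDef ∧ IsUnit (1 - Y * X).det ∧
        (∀ t : ℕ, (SDARE.fixedPointSeq (SDARE.stdA A B L R) (SDARE.stdB B R) C t -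
          (X - (SDARE.opSAdj A B (SDARE.feedback A B L R X) ^ t)
            (X * (1 - Y * X)⁻¹))).PosSemidef) ∧
        (∀ k : ℕ, (H k -
          (X - (SDARE.opSAdj A B (SDARE.feedback A B L R X) ^ 2 ^ k)
            (X * (1 - Y * X)⁻¹))).PosSemidef)) ∧
      (X ≠ 0 → ∃ ℓ : ℝ≥0,
        (ℓ : ℝ≥0∞) ≤ SDARE.opSpectralRadius (SDARE.opS A B (SDARE.feedback A B L R X)) ∧
        ∀ N : Seminorm ℝ (Matrix (Fin n) (Fin n) ℝ), (∀ Z, N Z = 0 → Z = 0) →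
          Tendsto (fun k : ℕ => (N (H k - X) / N X) ^ ((1 : ℝ) / (2 : ℝ) ^ k)) atTop
            (𝓝 (ℓ : ℝ))) ∧
      SDARE.opSpectralRadius (SDARE.opS A B (SDARE.feedback A B L R X)) < 1 := by
  set a : Fin r → Matrix (Fin n) (Fin n) ℝ := fun i => A i - B i * R⁻¹ * Lᵀ with ha
  set b : Fin r → Matrix (Fin n) (Fin m) ℝ := fun i => B i * CFC.sqrt R⁻¹ with hb
  have hA : stdA A B L R = interleave a := rfl
  have hB : stdB B R = interleave b := rfl
  rw [hA, hB] at hT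
  have hHk : ∀ k, H k = fixedPointSeq (interleave a) (interleave b) C (2 ^ k) := fun k => by
    rw [hH, hT]
    exact (doublingSeq_spec _ _ C k).2.2.2
  set x := fixedPointSeq (interleave a) (interleave b) C with hx
  obtain ⟨F, hF⟩ := hstab
  rw [opSpectralRadius_opS, ← conjSum_standardForm A B L hR] at hF
  obtain ⟨X, hX0, hX, hlim⟩ := exists_fixedPoint a b C hF
  obtain ⟨J, hJ⟩ := exists_of_detectable hdet
  have hXeq : X = conjSum (fun i => a i + b i * gain a b X) X +
      ((gain a b X)ᵀ * gain a b X + Cᵀ * C) := by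
    rw [← opD_eq a b C hX0]
    exact hX
  have hs := stable_of_detectable a b C J hJ hX0 hXeq
  have hSeq : conjSum (fun i => a i + b i * gain a b X) = opSAdj A B (feedback A B L R X) :=
    conjSum_gain A B L hR hX0
  have hρ : opSpectralRadius (opS A B (feedback A B L R X)) =
      opSpectralRadius (conjSum fun i => a i + b i * gain a b X) := by
    rw [opSpectralRadius_opS, hSeq]
  have hmono : Monotone x := fixedPointSeq_mono a b C
  have hlow := pow_le_error hX0 hX
  obtain ⟨c, hc, hup⟩ := exists_error_le hX0 hX hs hlim
  obtain ⟨Y, hY, hYu, hYc⟩ := exists_posDef_mul_inv_eq_smul hX0 hc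
  have hpow2 : Tendsto (fun k : ℕ => 2 ^ k) atTop atTop :=
    tendsto_pow_atTop_atTop_of_one_lt one_lt_two
  have hHlim : Tendsto H atTop (𝓝 X) := by
    have h := hlim.comp hpow2
    rwa [show x ∘ (fun k : ℕ => 2 ^ k) = H from (funext hHk).symm] at h
  have hbound : ∀ t : ℕ, (x t - (X - (opSAdj A B (feedback A B L R X) ^ t)
      (X * (1 - Y * X)⁻¹))).PosSemidef := by
    intro t
    rw [← Matrix.le_iff, ← hSeq, hYc, map_smul, sub_le_comm]
    exact hup t
  refine ⟨fun k => ?_, X, ⟨Matrix.nonneg_iff_posSemidef.mp hX0, hX, hρ ▸ hs⟩, fun X' hX' => ?_,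
    fun k => ?_, ?_, hHlim, ⟨Y, hY, hYu, hbound, fun k => ?_⟩, fun hne => ?_, hρ ▸ hs⟩
  · rw [hT]
    obtain ⟨hG, hH', -, -⟩ := doublingSeq_spec (interleave a) (interleave b) C k
    exact isUnit_det_one_add_mul hG (kronecker_one_nonneg hH')
  · have hX'0 : 0 ≤ X' := Matrix.nonneg_iff_posSemidef.mpr hX'.posSemidef
    refine le_antisymm (le_of_fixedPoint a b C hX0 hX'0 hX hX'.eq_opD hs) ?_
    exact le_of_tendsto_of_le hlim tendsto_const_nhds
      (Eventually.of_forall (fixedPointSeq_le a b C hX'0 hX'.eq_opD))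
  · rw [← Matrix.le_iff, hHk, hHk]
    exact hmono (Nat.pow_le_pow_right two_pos k.le_succ)
  · by_cases hex : ∃ k, H (k + 1) = H k
    · classical
      refine Or.inl ⟨Nat.find hex, fun k hk => ?_, fun k hk => Nat.find_min hex hk⟩
      set K := Nat.find hex
      have hK : x (2 ^ (K + 1)) = x (2 ^ K) := by
        rw [← hHk, ← hHk]
        exact Nat.find_spec hex
      -- by monotonicity the fixed point iteration stalls already after one step
      have hstep : x (2 ^ K + 1) = x (2 ^ K) := by
        refine le_antisymm ?_ (hmono (Nat.le_succ _))
        rw [← hK]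
        refine hmono ?_
        rw [pow_succ]
        have := Nat.one_le_two_pow (n := K)
        omega
      have hconst : ∀ s, x (2 ^ K + s) = x (2 ^ K) := by
        intro s
        induction s with
        | zero => rfl
        | succ s ih =>
          have h1 : x (2 ^ K + (s + 1)) = opD (interleave a) (interleave b) C (x (2 ^ K + s)) := rfl
          rw [h1, ih]
          exact hstep
      have hev : ∀ t, 2 ^ K ≤ t → x t = x (2 ^ K) := by
        intro t ht
        obtain ⟨s, rfl⟩ := Nat.exists_eq_add_of_le ht
        exact hconst s
      have hXK : X = x (2 ^ K) :=
        tendsto_nhds_unique hlim (tendsto_const_nhds.congr'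
          (eventually_atTop.mpr ⟨2 ^ K, fun t ht => (hev t ht).symm⟩))
      rw [hHk, hXK]
      exact hev _ (Nat.pow_le_pow_right two_pos hk)
    · exact Or.inr fun k hk => hex ⟨k, hk⟩
  · rw [hHk]
    exact hbound (2 ^ k)
  · have hle : conjSum (fun i => a i + b i * gain a b X) X ≤ X := by
      conv_rhs => rw [hXeq]
      exact le_add_of_nonneg_right
        (add_nonneg (transpose_mul_self_nonneg _) (transpose_mul_self_nonneg C))
    obtain ⟨ℓ, hℓ, hN⟩ := exists_rate hX0 hne hle hc hlow hup
    refine ⟨ℓ, hρ ▸ hℓ, fun N hN0 => (hN N hN0).congr fun k => ?_⟩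
    rw [hHk, map_sub_rev]
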